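/- All graphs are finite, simple and undirected. For a connected graph $G$ with vertices $v_1,\dots,v_n$, let $D(G)=(d_G(v_i,v_j))_{i,j}$ be its distance matrix, where $d_G$ is the length of a shortest path, and let the distance spectral radius $\rho(G)$ be the largest eigenvalue of $D(G)$. Let $K_4^{(n)}$ $(n\ge 4)$ be the kite graph of order $n$ obtained from the complete graph $K_4$ by attaching a path of length $n-4$ at one of its vertices. Three subgraphs $G_1,G_2,G_3$ of $G$ are said to form three cactus-type cycles in $G$ if they are pairwise edge-disjoint cycles and the subgraph of $G$ induced by the edge set $E(G_1)\cup E(G_2)\cup E(G_3)$ contains exactly three cycles. Lemma. If $G$ is a connected graph of order $n$ having three cactus-type cycles, then $$\rho(G)<\rho\bigl(K_4^{(n)}\bigr).$$ -/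

import Mathlib

namespace DistSpec

/-- The distance matrix of a graph, `D(G)_{uv} = d_G(u, v)`, with real entries. -/
noncomputable def distMatrix {V : Type*} (G : SimpleGraph V) : Matrix V V ℝ :=
  Matrix.of fun u v => (G.dist u v : ℝ)

/-- The distance spectral radius: the largest eigenvalue of the distance matrix.
The real spectrum of a real symmetric matrix over a nonempty finite index type is a nonempty
finite set, so the supremum is attained: see `isGreatest_distSpectralRadius`. -/
noncomputable def distSpectralRadius {V : Type*} [Fintype V] [DecidableEq V]
    (G : SimpleGraph V) : ℝ :=
  sSup (spectrum ℝ (distMatrix G))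

theorem isHermitian_distMatrix {V : Type*} (G : SimpleGraph V) :
    (distMatrix G).IsHermitian := by
  ext u v
  simp [distMatrix, SimpleGraph.dist_comm]

theorem isGreatest_distSpectralRadius {V : Type*} [Fintype V] [DecidableEq V] [Nonempty V]
    (G : SimpleGraph V) : IsGreatest (spectrum ℝ (distMatrix G)) (distSpectralRadius G) := by
  have h := (isHermitian_distMatrix G).spectrum_real_eq_range_eigenvalues
  have hfin : (spectrum ℝ (distMatrix G)).Finite := h ▸ Set.finite_range _
  have hne : (spectrum ℝ (distMatrix G)).Nonempty := h ▸ Set.range_nonempty _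
  exact ⟨hne.csSup_mem hfin, fun x hx => le_csSup hfin.bddAbove hx⟩

/-- The kite graph `K_k^{(n)}` on the vertices `0, …, n - 1` (for `1 ≤ k ≤ n`): the vertices
`0, …, k - 1` form a clique, and the path `k - 1, k, …, n - 1` of length `n - k` is attached to it
at the vertex `k - 1`. -/
def kite (k n : ℕ) : SimpleGraph (Fin n) where
  Adj i j := i ≠ j ∧
    ((i.val < k ∧ j.val < k) ∨ i.val + 1 = j.val ∨ j.val + 1 = i.val)
  symm := ⟨fun i j h => ⟨h.1.symm, by have := h.2; tauto⟩⟩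
  loopless := ⟨fun _ h => h.1 rfl⟩

/-- A subgraph is a cycle if it consists of the vertices and edges of a closed walk that
repeats no vertex (other than its endpoint) and no edge. -/
def IsCycleSubgraph {V : Type*} {G : SimpleGraph V} (C : G.Subgraph) : Prop :=
  ∃ (v : V) (p : G.Walk v v), p.IsCycle ∧ p.toSubgraph = C

/-- The edge-induced subgraph: its edges are the edges of `G` in `S`, and its vertices are
the end vertices of these edges. -/
def edgeInduced {V : Type*} (G : SimpleGraph V) (S : Set (Sym2 V)) : G.Subgraph where
  verts := {u | ∃ v, G.Adj u v ∧ s(u, v) ∈ S}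
  Adj u v := G.Adj u v ∧ s(u, v) ∈ S
  adj_sub h := h.1
  edge_vert {_ v} h := ⟨v, h⟩
  symm := ⟨fun u v h => ⟨h.1.symm, by rw [Sym2.eq_swap]; exact h.2⟩⟩

/-- `G₁`, `G₂`, `G₃` form three cactus-type cycles in `G`: they are pairwise edge-disjoint cycles,
and the subgraph induced by the union of their edge sets contains exactly three cycles. -/
def AreCactusTypeCycles {V : Type*} {G : SimpleGraph V} (G₁ G₂ G₃ : G.Subgraph) : Prop :=
  IsCycleSubgraph G₁ ∧ IsCycleSubgraph G₂ ∧ IsCycleSubgraph G₃ ∧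
  Disjoint G₁.edgeSet G₂.edgeSet ∧ Disjoint G₁.edgeSet G₃.edgeSet ∧
  Disjoint G₂.edgeSet G₃.edgeSet ∧
  {C : G.Subgraph | IsCycleSubgraph C ∧
    C ≤ edgeInduced G (G₁.edgeSet ∪ G₂.edgeSet ∪ G₃.edgeSet)}.encard = 3

end DistSpec

/-! By a Perron argument (`distSpectralRadius_lt_of_distForm_lt`) it suffices, for every positive
weight `x`, to place the vertices of `G` on the kite so that the quadratic form of the distances
strictly increases. Deleting edges only increases distances, so `G` may be replaced by a minimal
connected spanning subgraph containing the three cycles. Its edges off the cycles are bridges, hence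
each cycle is gated: deleting its edges separates its vertices from each other, and each of them
carries a pile of hanging vertices (`exists_three_gatedCycles`).

Choose a cycle, and a vertex `w` of it at which another cycle hangs, such that the weight `P` of the
set `X` of vertices hanging elsewhere is minimal. Then the third cycle hangs at `w` too
(`exists_light_cycle`), so the pile `Q` at `w` contains two cycles. Put an extra weight `P` at `w`
to stand for `X`. Unfolding each of the two cycles into a path gains at least `P * x(Q)`
(`GatedCycle.exists_unfold`, `pile_bound`), and what remains can be straightened into a path without
loss (`exists_path_order`).

The set `X` goes onto the clique end of the kite (`GatedCycle.exists_kite_order`). Distances between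
`X` and `Q` may drop by one there, which costs at most `2 * P * x(Q)` over ordered pairs: exactly
what the two unfolded cycles pay. Losses inside `X` are balanced against slack in the cross
distances, because `P ≤ x(Q)` (`kerForm_lt_of_glue`). Strictness comes from leftover slack in the
placement of `X`. -/

namespace DistSpec

/-- The quadratic form of the distance matrix. -/
noncomputable def distForm {V : Type*} [Fintype V] (G : SimpleGraph V) (x : V → ℝ) : ℝ :=
  ∑ u, ∑ v, x u * x v * (G.dist u v : ℝ)

/-! ### Perron theory and the variational comparison of spectral radii. -/

section Perron

variable {V : Type*} [Fintype V] (G : SimpleGraph V)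

theorem dotProduct_distMatrix_mulVec (x : V → ℝ) :
    x ⬝ᵥ (distMatrix G).mulVec x = distForm G x := by
  simp only [dotProduct, Matrix.mulVec, distMatrix, Matrix.of_apply, distForm, Finset.mul_sum]
  refine Finset.sum_congr rfl fun u _ => Finset.sum_congr rfl fun v _ => by ring

variable [DecidableEq V]

/-- This single fact yields both the Rayleigh bound and its equality case, since a positive
semidefinite form vanishes only on the kernel of its matrix. -/
theorem posSemidef_distSpectralRadius_sub [Nonempty V] :
    (distSpectralRadius G • (1 : Matrix V V ℝ) - distMatrix G).PosSemidef := by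
  have hH : (distSpectralRadius G • (1 : Matrix V V ℝ) - distMatrix G).IsHermitian := by
    refine Matrix.IsHermitian.sub ?_ (isHermitian_distMatrix G)
    rw [Matrix.IsHermitian, Matrix.conjTranspose_smul, Matrix.conjTranspose_one]
    simp
  rw [hH.posSemidef_iff_eigenvalues_nonneg]
  intro i
  obtain ⟨μ, hμ⟩ : ∃ μ, μ = hH.eigenvalues i := ⟨_, rfl⟩
  have h1 : μ ∈
      spectrum ℝ (distSpectralRadius G • (1 : Matrix V V ℝ) - distMatrix G) := by
    rw [hH.spectrum_real_eq_range_eigenvalues, hμ]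
    exact ⟨i, rfl⟩
  rw [← Algebra.algebraMap_eq_smul_one, ← spectrum.singleton_sub_eq] at h1
  obtain ⟨a, ha, b, hb, hab⟩ := Set.mem_sub.1 h1
  rw [Set.mem_singleton_iff] at ha
  have := (isGreatest_distSpectralRadius G).2 hb
  show 0 ≤ hH.eigenvalues i
  rw [← hμ, ← hab, ha]
  linarith

theorem dotProduct_sub_mulVec (x : V → ℝ) :
    x ⬝ᵥ (distSpectralRadius G • (1 : Matrix V V ℝ) - distMatrix G).mulVec x =
      distSpectralRadius G * ∑ v, x v ^ 2 - distForm G x := by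
  rw [Matrix.sub_mulVec, dotProduct_sub, dotProduct_distMatrix_mulVec, Matrix.smul_mulVec,
    Matrix.one_mulVec, dotProduct_smul]
  simp [dotProduct, sq]

theorem distForm_le [Nonempty V] (x : V → ℝ) :
    distForm G x ≤ distSpectralRadius G * ∑ v, x v ^ 2 := by
  have h := (posSemidef_distSpectralRadius_sub G).dotProduct_mulVec_nonneg x
  rw [star_trivial, dotProduct_sub_mulVec] at h
  linarith

theorem exists_eigenvector [Nonempty V] :
    ∃ x : V → ℝ, x ≠ 0 ∧ (distMatrix G).mulVec x = distSpectralRadius G • x := by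
  have h := (isGreatest_distSpectralRadius G).1
  rw [(isHermitian_distMatrix G).spectrum_real_eq_range_eigenvalues] at h
  obtain ⟨i, hi⟩ := h
  refine ⟨⇑((isHermitian_distMatrix G).eigenvectorBasis i), ?_, ?_⟩
  · intro h0
    have := (isHermitian_distMatrix G).eigenvectorBasis.orthonormal.ne_zero i
    apply this
    ext v
    exact congrFun h0 v
  · have := (isHermitian_distMatrix G).mulVec_eigenvectorBasis i
    rw [this, hi]

variable {G}

/-- Taking absolute values in a top eigenvector cannot decrease the form, as all distances are
nonnegative, so `|x|` is again an eigenvector. A zero entry would make a sum of nonnegative terms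
vanish, although off-diagonal distances are positive and some entry is nonzero. -/
theorem exists_pos_distForm_eq [Nontrivial V] (hG : G.Connected) :
    ∃ x : V → ℝ, (∀ v, 0 < x v) ∧ distForm G x = distSpectralRadius G * ∑ v, x v ^ 2 := by
  obtain ⟨x, hx0, hx⟩ := exists_eigenvector G
  set y : V → ℝ := fun v => |x v| with hy
  have hxe : distForm G x = distSpectralRadius G * ∑ v, x v ^ 2 := by
    rw [← dotProduct_distMatrix_mulVec, hx, dotProduct_smul]
    simp [dotProduct, sq]
  have hsq : ∑ v, y v ^ 2 = ∑ v, x v ^ 2 := by simp [hy]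
  have hxy : distForm G x ≤ distForm G y := by
    refine Finset.sum_le_sum fun u _ => Finset.sum_le_sum fun v _ => ?_
    have : x u * x v ≤ y u * y v := by
      simp only [hy, ← abs_mul]
      exact le_abs_self _
    exact mul_le_mul_of_nonneg_right this (Nat.cast_nonneg _)
  have hye : distForm G y = distSpectralRadius G * ∑ v, y v ^ 2 :=
    le_antisymm (distForm_le G y) (by rw [hsq, ← hxe]; exact hxy)
  refine ⟨y, ?_, hye⟩
  have h0 := (posSemidef_distSpectralRadius_sub G).dotProduct_mulVec_zero_iff y
  rw [star_trivial, dotProduct_sub_mulVec, hye, sub_self] at h0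
  have h1 := h0.1 rfl
  rw [Matrix.sub_mulVec, Matrix.smul_mulVec, Matrix.one_mulVec, sub_eq_zero] at h1
  obtain ⟨w, hw⟩ : ∃ w, x w ≠ 0 := by
    by_contra! h
    exact hx0 (funext h)
  have hyw : 0 < y w := abs_pos.2 hw
  have hrow : ∀ v, distSpectralRadius G * y v = ∑ u, (G.dist v u : ℝ) * y u := fun v => by
    have := congrFun h1 v
    simpa [Matrix.mulVec, dotProduct, distMatrix] using this
  intro v
  rcases (abs_nonneg (x v)).lt_or_eq with h | h
  · exact h
  exfalso
  have hv : y v = 0 := h.symm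
  have hvw : v ≠ w := by
    rintro rfl
    exact hyw.ne' hv
  have h2 := hrow v
  rw [hv, mul_zero] at h2
  have h3 := (Finset.sum_eq_zero_iff_of_nonneg fun u _ =>
    mul_nonneg (Nat.cast_nonneg (G.dist v u)) (abs_nonneg (x u))).1 h2.symm w (Finset.mem_univ _)
  have h4 : 0 < G.dist v w := hG.pos_dist_of_ne hvw
  have h5 : (0 : ℝ) < G.dist v w := by exact_mod_cast h4
  exact (mul_pos h5 hyw).ne' h3

/-- To compare distance spectral radii it suffices to compare the quadratic forms on positive
vectors, up to a relabelling of the vertices. -/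
theorem distSpectralRadius_lt_of_distForm_lt {W : Type*} [Fintype W] [DecidableEq W]
    [Nontrivial V] (hG : G.Connected) (K : SimpleGraph W)
    (h : ∀ x : V → ℝ, (∀ v, 0 < x v) →
      ∃ σ : V ≃ W, distForm G x < distForm K (x ∘ σ.symm)) :
    distSpectralRadius G < distSpectralRadius K := by
  obtain ⟨x, hx, he⟩ := exists_pos_distForm_eq hG
  obtain ⟨σ, hσ⟩ := h x hx
  have : Nonempty W := ⟨σ (Classical.arbitrary V)⟩
  have h1 := distForm_le K (x ∘ σ.symm)
  have h2 : ∑ w, (x ∘ σ.symm) w ^ 2 = ∑ v, x v ^ 2 :=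
    Equiv.sum_comp σ.symm fun v => x v ^ 2
  rw [h2] at h1
  rw [he] at hσ
  have h3 : 0 < ∑ v, x v ^ 2 := Finset.sum_pos (fun v _ => pow_pos (hx v) 2) Finset.univ_nonempty
  exact lt_of_mul_lt_mul_right (hσ.trans_le h1) h3.le

end Perron

end DistSpec

/-! ### Straightening a connected graph into a path. -/

namespace DistSpec

/-- The quadratic form of a kernel `k`, restricted to a finite set. -/
noncomputable def kerForm {V : Type*} (s : Finset V) (k : V → V → ℝ) (y : V → ℝ) : ℝ :=
  ∑ u ∈ s, ∑ v ∈ s, y u * y v * k u v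

section KerForm

variable {V : Type*} [DecidableEq V]

theorem kerForm_insert {s : Finset V} {v : V} (hv : v ∉ s) {k : V → V → ℝ}
    (hsymm : ∀ a b, k a b = k b a) (hself : ∀ a, k a a = 0) (y : V → ℝ) :
    kerForm (insert v s) k y = kerForm s k y + 2 * (y v * ∑ z ∈ s, y z * k v z) := by
  unfold kerForm
  rw [Finset.sum_insert hv, Finset.sum_insert hv, hself]
  simp_rw [Finset.sum_insert hv, Finset.sum_add_distrib]
  have h1 : ∑ z ∈ s, y v * y z * k v z = y v * ∑ z ∈ s, y z * k v z := by
    rw [Finset.mul_sum]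
    exact Finset.sum_congr rfl fun z _ => by ring
  have h2 : ∑ z ∈ s, y z * y v * k z v = y v * ∑ z ∈ s, y z * k v z := by
    rw [Finset.mul_sum]
    exact Finset.sum_congr rfl fun z _ => by rw [hsymm z v]; ring
  rw [h1, h2]
  ring

/-- The change is linear in `c` because the diagonal of `k` vanishes. This describes moving the
weight of a removed vertex onto `u`. -/
theorem kerForm_add_single {s : Finset V} {u : V} (hu : u ∈ s) {k : V → V → ℝ}
    (hsymm : ∀ a b, k a b = k b a) (hself : ∀ a, k a a = 0) (y : V → ℝ) (c : ℝ) :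
    kerForm s k (fun z => y z + if z = u then c else 0) =
      kerForm s k y + 2 * (c * ∑ z ∈ s, y z * k u z) := by
  unfold kerForm
  have h : ∀ a b, (y a + if a = u then c else 0) * (y b + if b = u then c else 0) * k a b =
      y a * y b * k a b + (if a = u then c * (y b * k a b) else 0) +
        (if b = u then c * (y a * k a b) else 0) +
        (if a = u then if b = u then c * c * k a b else 0 else 0) := by
    intro a b
    split_ifs <;> ring
  simp_rw [h, Finset.sum_add_distrib]
  simp only [Finset.sum_ite_eq', hu, if_true]
  have h3 : ∑ x ∈ s, ∑ x_1 ∈ s, (if x = u then c * (y x_1 * k x x_1) else 0) =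
      c * ∑ z ∈ s, y z * k u z := by
    rw [Finset.sum_comm]
    simp only [Finset.sum_ite_eq', hu, if_true, Finset.mul_sum]
  have h4 : ∑ x ∈ s, c * (y x * k x u) = c * ∑ z ∈ s, y z * k u z := by
    rw [Finset.mul_sum]
    exact Finset.sum_congr rfl fun z _ => by rw [hsymm z u]
  have h5 : ∑ x ∈ s, ∑ x_1 ∈ s, (if x = u then if x_1 = u then c * c * k x x_1 else 0 else 0)
      = 0 := by
    refine Finset.sum_eq_zero fun a _ => Finset.sum_eq_zero fun b _ => ?_
    split_ifs with ha hb
    · rw [ha, hb, hself, mul_zero]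
    · rfl
    · rfl
  rw [h3, h4, h5]
  ring

/-- Opening up a cut: the kernel `T + (c - c')²` on `s` together with a new point next to `u`. -/
theorem kerForm_split {s : Finset V} {u v : V} (hu : u ∈ s) (hv : v ∉ s) {d T N : V → V → ℝ}
    (hd : ∀ a b, d a b = d b a) (hd0 : ∀ a, d a a = 0)
    (hT : ∀ a b, T a b = T b a) (hT0 : ∀ a, T a a = 0)
    (hN : ∀ a b, N a b = N b a) (hN0 : ∀ a, N a a = 0)
    {y : V → ℝ} (hy : ∀ z, 0 ≤ y z) (hduv : ∀ z ∈ s, d v z ≤ d u z + 1)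
    (hle : kerForm s d (fun z => y z + if z = u then y v else 0) ≤
      kerForm s T (fun z => y z + if z = u then y v else 0))
    {c : V → ℝ} (hc : ∀ z, c z = 0 ∨ c z = 1)
    (hNs : ∀ a ∈ s, ∀ b ∈ s, N a b = T a b + (c a - c b) ^ 2)
    (hNv : ∀ z ∈ s, N v z = T u z + (1 - c z)) (hr : ∃ r ∈ s, c r = 0 ∧ y v ≤ y r) :
    kerForm (insert v s) d y ≤ kerForm (insert v s) N y := by
  rw [kerForm_add_single hu hd hd0, kerForm_add_single hu hT hT0] at hle
  rw [kerForm_insert hv hd hd0, kerForm_insert hv hN hN0]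
  -- Balance of the step: detaching `v` from `u` may raise `d` by one towards every `z`, but raises
  -- `N` only towards the side `c = 0`. The deficit is `y v` times the weight of the side `c = 1`.
  -- The opened cut gains the product of the weights of its two sides, and the side `c = 0` weighs
  -- at least `y r ≥ y v`.
  have h1 : ∑ z ∈ s, y z * d v z ≤ ∑ z ∈ s, y z * d u z + ∑ z ∈ s, y z := by
    rw [← Finset.sum_add_distrib]
    refine Finset.sum_le_sum fun z hz => ?_
    have := mul_le_mul_of_nonneg_left (hduv z hz) (hy z)
    linarith
  have h2 : ∑ z ∈ s, y z * N v z = ∑ z ∈ s, y z * T u z + ∑ z ∈ s, y z * (1 - c z) := by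
    rw [← Finset.sum_add_distrib]
    exact Finset.sum_congr rfl fun z hz => by rw [hNv z hz]; ring
  have hs : ∑ z ∈ s, y z = ∑ z ∈ s, y z * (1 - c z) + ∑ z ∈ s, y z * c z := by
    rw [← Finset.sum_add_distrib]
    exact Finset.sum_congr rfl fun z hz => by ring
  have hc0 : ∀ z, 0 ≤ c z := fun z => by rcases hc z with h | h <;> rw [h] <;> norm_num
  have hc1 : ∀ z, 0 ≤ 1 - c z := fun z => by rcases hc z with h | h <;> rw [h] <;> norm_num
  have h3 : kerForm s N y = kerForm s T y +
      2 * ((∑ z ∈ s, y z * (1 - c z)) * ∑ z ∈ s, y z * c z) := by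
    have e : ∀ a ∈ s, ∀ b ∈ s, y a * y b * N a b = y a * y b * T a b +
        ((y a * (1 - c a)) * (y b * c b) + (y a * c a) * (y b * (1 - c b))) := by
      intro a ha b hb
      rw [hNs a ha b hb]
      rcases hc a with h | h <;> rcases hc b with h' | h' <;> (rw [h, h']; ring)
    unfold kerForm
    rw [Finset.sum_congr rfl fun a ha => Finset.sum_congr rfl fun b hb => e a ha b hb]
    simp_rw [Finset.sum_add_distrib, ← Finset.mul_sum, ← Finset.sum_mul]
    ring
  obtain ⟨r, hrs, hr0, hr⟩ := hr
  have h4 : y v ≤ ∑ z ∈ s, y z * (1 - c z) := by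
    refine hr.trans ?_
    have := Finset.single_le_sum (f := fun z => y z * (1 - c z))
      (fun z _ => mul_nonneg (hy z) (hc1 z)) hrs
    simpa [hr0] using this
  have h5 : 0 ≤ ∑ z ∈ s, y z * c z := Finset.sum_nonneg fun z _ => mul_nonneg (hy z) (hc0 z)
  have h6 := mul_le_mul_of_nonneg_right h4 h5
  have h7 := mul_le_mul_of_nonneg_left h1 (hy v)
  rw [h2, h3]
  rw [hs] at h7
  nlinarith

end KerForm

section PathOrder

variable {V : Type*} [DecidableEq V]

theorem exists_adj_dist_lt {W : Type*} {H : SimpleGraph W} (hH : H.Preconnected) {r z : W}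
    (hz : z ≠ r) : ∃ z', H.Adj z z' ∧ H.dist r z' < H.dist r z := by
  obtain ⟨p, hp⟩ := (hH z r).exists_walk_length_eq_dist
  cases p with
  | nil => exact absurd rfl hz
  | cons h q =>
    refine ⟨_, h, ?_⟩
    rw [H.dist_comm (u := r) (v := z), ← hp, H.dist_comm]
    have := H.dist_le q
    simp only [SimpleGraph.Walk.length_cons]
    omega

/-- A vertex farthest from `r` can be removed without disconnecting the graph. -/
theorem exists_removable {G : SimpleGraph V} {s : Finset V}
    (hs : (G.induce (s : Set V)).Preconnected) {r : V} (hr : r ∈ s) (hcard : 1 < s.card) :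
    ∃ v ∈ s, v ≠ r ∧ (∃ u ∈ s, u ≠ v ∧ G.Adj v u) ∧
      (G.induce ((s.erase v : Finset V) : Set V)).Preconnected := by
  set H := G.induce (s : Set V) with hHdef
  let r' : (s : Set V) := ⟨r, hr⟩
  have : Nonempty (s : Set V) := ⟨r'⟩
  obtain ⟨v, hv⟩ := Finite.exists_max (fun z : (s : Set V) => H.dist r' z)
  have hvr : v ≠ r' := by
    rintro rfl
    obtain ⟨z, hz, hzr⟩ := Finset.exists_mem_ne hcard r
    have := hv ⟨z, hz⟩
    rw [SimpleGraph.dist_self] at this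
    have h0 := (hs r' ⟨z, hz⟩).dist_eq_zero_iff.1 (Nat.le_zero.1 this)
    exact hzr (congrArg Subtype.val h0).symm
  obtain ⟨u, hu, -⟩ := exists_adj_dist_lt hs hvr
  have hvr' : (v : V) ≠ r := fun h => hvr (Subtype.ext h)
  refine ⟨v, v.2, hvr', ⟨u, u.2, fun h => H.ne_of_adj hu (Subtype.ext h.symm), hu⟩, ?_⟩
  -- A neighbour strictly closer to `r` is never the farthest vertex `v`, so descending towards `r`
  -- avoids `v`.
  have key : ∀ n, ∀ z : (s : Set V), H.dist r' z = n → ∀ hz : (z : V) ∈ s.erase v,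
      (G.induce ((s.erase (v : V) : Finset V) : Set V)).Reachable ⟨z, hz⟩
        ⟨r, Finset.mem_erase.2 ⟨hvr'.symm, hr⟩⟩ := by
    intro n
    induction n using Nat.strong_induction_on with
    | _ n ih =>
      intro z hzn hz
      by_cases hzr : z = r'
      · subst hzr
        exact SimpleGraph.Reachable.refl _
      obtain ⟨z', hz', hlt⟩ := exists_adj_dist_lt hs hzr
      have hz'v : (z' : V) ≠ v := by
        intro h
        have h1 : z' = v := Subtype.ext h
        have := hv z
        rw [← h1] at this
        omega
      have hz's : (z' : V) ∈ s.erase v := Finset.mem_erase.2 ⟨hz'v, z'.2⟩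
      have := ih _ (hzn ▸ hlt) z' rfl hz's
      exact SimpleGraph.Reachable.trans (SimpleGraph.Adj.reachable (show
        (G.induce ((s.erase (v : V) : Finset V) : Set V)).Adj ⟨z, hz⟩ ⟨z', hz's⟩ from hz')) this
  intro a b
  have ha := key _ ⟨a, (Finset.mem_erase.1 a.2).2⟩ rfl a.2
  have hb := key _ ⟨b, (Finset.mem_erase.1 b.2).2⟩ rfl b.2
  exact ha.trans hb.symm

/-- Induction: remove a non-cut vertex `v` other than a heaviest vertex `r`, move its weight to a
neighbour `u`, order the rest, and reinsert `v` next to `u` on the side away from `r`. Then `r` lies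
on the side `c = 0` required by `kerForm_split`. -/
theorem exists_path_order_finset {G : SimpleGraph V} {d : V → V → ℝ}
    (hd : ∀ a b, d a b = d b a) (hd0 : ∀ a, d a a = 0)
    (hadj : ∀ a b z, G.Adj a b → d a z ≤ d b z + 1) (n : ℕ) :
    ∀ s : Finset V, s.card = n + 1 → (G.induce (s : Set V)).Preconnected →
      ∀ y : V → ℝ, (∀ v, 0 ≤ y v) → ∃ t : V → ℕ, (∀ v ∈ s, t v < n + 1) ∧
        Set.InjOn t s ∧ kerForm s d y ≤ kerForm s (fun a b => |(t a : ℝ) - t b|) y := by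
  induction n with
  | zero =>
    intro s hs _ y _
    obtain ⟨a, rfl⟩ := Finset.card_eq_one.1 hs
    exact ⟨fun _ => 0, by simp, by simp, by simp [kerForm, hd0]⟩
  | succ n ih =>
    intro s hs hconn y hy
    obtain ⟨r, hr, hmax⟩ := s.exists_max_image y (Finset.card_pos.1 (by omega))
    obtain ⟨v, hv, hvr, ⟨u, hu, huv, hvu⟩, hconn'⟩ := exists_removable hconn hr (by omega)
    have hvs : v ∉ s.erase v := Finset.notMem_erase v s
    have hus : u ∈ s.erase v := Finset.mem_erase.2 ⟨huv, hu⟩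
    have hrs : r ∈ s.erase v := Finset.mem_erase.2 ⟨hvr.symm, hr⟩
    obtain ⟨t, ht, hinj, hle⟩ := ih (s.erase v) (by rw [Finset.card_erase_of_mem hv]; omega)
      hconn' (fun z => y z + if z = u then y v else 0)
      (fun z => add_nonneg (hy z) (by split_ifs <;> simp [hy]))
    have hins : insert v (s.erase v) = s := Finset.insert_erase hv
    have hmem : ∀ z ∈ s, z ≠ v → z ∈ s.erase v := fun z hz h => Finset.mem_erase.2 ⟨h, hz⟩
    have hinj' : ∀ a ∈ s.erase v, ∀ b ∈ s.erase v, t a = t b → a = b :=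
      fun a ha b hb h => hinj ha hb h
    have hne : ∀ z ∈ s.erase v, z ≠ v := fun z hz => (Finset.mem_erase.1 hz).1
    rcases le_or_gt (t r) (t u) with hru | hru
    -- Here `r` is not after `u`: `v` goes just after `u`, and everything later shifts by one.
    · refine ⟨fun z => if z = v then t u + 1 else if t u < t z then t z + 1 else t z, ?_, ?_, ?_⟩
      · intro z hz
        have := ht u hus
        by_cases hzv : z = v
        · simp only [hzv, if_true]; omega
        · have := ht z (hmem z hz hzv)
          simp only [hzv, if_false]; split_ifs <;> omega
      · intro a ha b hb hab
        by_cases hav : a = v <;> by_cases hbv : b = v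
        · rw [hav, hbv]
        · simp only [hav, hbv, if_true, if_false] at hab
          split_ifs at hab <;> omega
        · simp only [hav, hbv, if_true, if_false] at hab
          split_ifs at hab <;> omega
        · simp only [hav, hbv, if_false] at hab
          refine hinj' a (hmem a ha hav) b (hmem b hb hbv) ?_
          split_ifs at hab <;> omega
      · rw [← hins]
        refine kerForm_split hus hvs hd hd0 (fun a b => abs_sub_comm _ _) (fun a => by simp)
          (fun a b => abs_sub_comm _ _) (fun a => by simp) hy (fun z _ => hadj v u z hvu) hle
          (c := fun z => if t u < t z then 1 else 0) (fun z => by split_ifs <;> simp) ?_ ?_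
          ⟨r, hrs, by simp [hru], hmax v hv⟩
        · intro a ha b hb
          simp only [hne a ha, hne b hb, if_false]
          split_ifs with h1 h2 h2
          · simp
          · have : (t b : ℝ) < t a := by exact_mod_cast (by omega : t b < t a)
            push_cast
            rw [abs_of_pos (by linarith), abs_of_pos (by linarith)]; ring
          · have : (t a : ℝ) < t b := by exact_mod_cast (by omega : t a < t b)
            push_cast
            rw [abs_of_neg (by linarith), abs_of_neg (by linarith)]; ring
          · simp
        · intro z hz
          simp only [hne z hz, if_true, if_false]
          split_ifs with h1
          · push_cast; rw [show (t u : ℝ) + 1 - (t z + 1) = t u - t z by ring]; ring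
          · have : (t z : ℝ) ≤ t u := by exact_mod_cast (by omega : t z ≤ t u)
            push_cast
            rw [abs_of_nonneg (by linarith), abs_of_nonneg (by linarith)]; ring
    -- Mirror case: `v` takes the place of `u`, while `u` and everything later, including `r`,
    -- shifts by one.
    · refine ⟨fun z => if z = v then t u else if t u ≤ t z then t z + 1 else t z, ?_, ?_, ?_⟩
      · intro z hz
        have := ht u hus
        by_cases hzv : z = v
        · simp only [hzv, if_true]; omega
        · have := ht z (hmem z hz hzv)
          simp only [hzv, if_false]; split_ifs <;> omega
      · intro a ha b hb hab
        by_cases hav : a = v <;> by_cases hbv : b = v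
        · rw [hav, hbv]
        · simp only [hav, hbv, if_true, if_false] at hab
          split_ifs at hab <;> omega
        · simp only [hav, hbv, if_true, if_false] at hab
          split_ifs at hab <;> omega
        · simp only [hav, hbv, if_false] at hab
          refine hinj' a (hmem a ha hav) b (hmem b hb hbv) ?_
          split_ifs at hab <;> omega
      · rw [← hins]
        refine kerForm_split hus hvs hd hd0 (fun a b => abs_sub_comm _ _) (fun a => by simp)
          (fun a b => abs_sub_comm _ _) (fun a => by simp) hy (fun z _ => hadj v u z hvu) hle
          (c := fun z => if t u ≤ t z then 0 else 1) (fun z => by split_ifs <;> simp) ?_ ?_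
          ⟨r, hrs, by simp [hru.le], hmax v hv⟩
        · intro a ha b hb
          simp only [hne a ha, hne b hb, if_false]
          split_ifs with h1 h2 h2
          · simp
          · have : (t b : ℝ) < t a := by exact_mod_cast (by omega : t b < t a)
            push_cast
            rw [abs_of_pos (by linarith), abs_of_pos (by linarith)]; ring
          · have : (t a : ℝ) < t b := by exact_mod_cast (by omega : t a < t b)
            push_cast
            rw [abs_of_neg (by linarith), abs_of_neg (by linarith)]; ring
          · simp
        · intro z hz
          simp only [hne z hz, if_true, if_false]
          split_ifs with h1
          · have : (t u : ℝ) ≤ t z := by exact_mod_cast h1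
            push_cast
            rw [abs_of_nonpos (by linarith), abs_of_nonpos (by linarith)]; ring
          · ring

/-- Among connected graphs, paths maximize the distance form, for a suitable order of the
weights. -/
theorem exists_path_order [Fintype V] {G : SimpleGraph V} (hG : G.Connected) {y : V → ℝ}
    (hy : ∀ v, 0 ≤ y v) : ∃ t : V → ℕ, (∀ v, t v < Fintype.card V) ∧ Function.Injective t ∧
      distForm G y ≤ ∑ u, ∑ v, y u * y v * |(t u : ℝ) - t v| := by
  have hpos : 0 < Fintype.card V := by
    have := hG.nonempty
    exact Fintype.card_pos
  have hconn : (G.induce ((Finset.univ : Finset V) : Set V)).Preconnected := by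
    rw [Finset.coe_univ]
    exact (SimpleGraph.induceUnivIso G).preconnected_iff.2 hG.preconnected
  obtain ⟨t, h1, h2, h3⟩ := exists_path_order_finset (G := G)
    (d := fun a b => (G.dist a b : ℝ)) (fun a b => by rw [G.dist_comm]) (fun a => by simp)
    (fun a b z hab => by
      have := hG.dist_triangle (u := a) (v := b) (w := z)
      rw [SimpleGraph.dist_eq_one_iff_adj.2 hab] at this
      have : G.dist a z ≤ G.dist b z + 1 := by omega
      exact_mod_cast this) (Fintype.card V - 1) Finset.univ
    (by rw [Finset.card_univ]; omega) hconn y hy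
  refine ⟨t, fun v => ?_, fun a b h => h2 (by simp) (by simp) h, h3⟩
  have := h1 v (Finset.mem_univ _)
  omega

end PathOrder

end DistSpec

/-! ### Gated cycles and how their unfolding changes distances. -/

namespace DistSpec

/-- A cycle `r 0, r 1, …` of length `ℓ` (indices taken modulo `ℓ`) in `G` together with a map `γ`
that sends every vertex to the vertex of the cycle at which it hangs: the edges of `G` that are not
edges of the cycle join vertices hanging at the same vertex. -/
structure GatedCycle {V : Type*} (G : SimpleGraph V) (ℓ : ℕ) (r : ℕ → V) (γ : V → V) : Prop where
  three_le : 3 ≤ ℓ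
  eq_iff : ∀ i j, r i = r j ↔ i % ℓ = j % ℓ
  adj : ∀ j, G.Adj (r j) (r (j + 1))
  gate_mem : ∀ u, ∃ j, γ u = r j
  gate_self : ∀ j, γ (r j) = r j
  edge : ∀ u v, G.Adj u v → γ u = γ v ∨ ∃ j, s(u, v) = s(r j, r (j + 1))

namespace GatedCycle

variable {V : Type*} {G : SimpleGraph V} {ℓ : ℕ} {r : ℕ → V} {γ : V → V}

theorem add_period (h : GatedCycle G ℓ r γ) (j k : ℕ) : r (j + ℓ * k) = r j :=
  (h.eq_iff _ _).2 (Nat.add_mul_mod_self_left j ℓ k)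

theorem rotate (h : GatedCycle G ℓ r γ) (k : ℕ) : GatedCycle G ℓ (fun j => r (j + k)) γ := by
  have hk : ∀ j, ∃ i, i + k = j + ℓ * k := fun j => by
    refine ⟨j + ℓ * k - k, Nat.sub_add_cancel ?_⟩
    have := Nat.le_mul_of_pos_left k (show 0 < ℓ by have := h.three_le; omega)
    omega
  refine ⟨h.three_le, fun i j => ?_, fun j => ?_, fun u => ?_, fun j => h.gate_self _,
    fun u v huv => ?_⟩
  · rw [h.eq_iff]
    exact ⟨fun e => Nat.ModEq.add_right_cancel' k e, fun e => Nat.ModEq.add_right k e⟩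
  · have := h.adj (j + k)
    rwa [show j + k + 1 = j + 1 + k by ring] at this
  · obtain ⟨j, hj⟩ := h.gate_mem u
    obtain ⟨i, hi⟩ := hk j
    exact ⟨i, by rw [hi, h.add_period, hj]⟩
  · refine (h.edge u v huv).imp id ?_
    rintro ⟨j, hj⟩
    obtain ⟨i, hi⟩ := hk j
    refine ⟨i, ?_⟩
    rw [show i + 1 + k = j + 1 + ℓ * k by omega, hi, h.add_period, h.add_period, hj]

theorem exists_index (h : GatedCycle G ℓ r γ) : ∃ idx : V → ℕ, ∀ u, idx u < ℓ ∧ r (idx u) = γ u := by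
  have : ∀ u, ∃ j, j < ℓ ∧ r j = γ u := fun u => by
    obtain ⟨j, hj⟩ := h.gate_mem u
    exact ⟨j % ℓ, Nat.mod_lt _ (by have := h.three_le; omega), by
      rw [hj, h.eq_iff, Nat.mod_mod]⟩
  choose idx hidx using this
  exact ⟨idx, hidx⟩

theorem edge_gate (h : GatedCycle G ℓ r γ) {u v : V} (huv : G.Adj u v) :
    γ u = γ v ∨ (γ u = u ∧ γ v = v) := by
  refine (h.edge u v huv).imp id ?_
  rintro ⟨j, hj⟩
  rcases Sym2.eq_iff.1 hj with ⟨rfl, rfl⟩ | ⟨rfl, rfl⟩ <;> exact ⟨h.gate_self _, h.gate_self _⟩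

/-- The first step of a geodesic from an off-cycle vertex to its gate is not a cycle edge, so it
stays in the pile. -/
theorem exists_parent (h : GatedCycle G ℓ r γ) (hG : G.Connected) {u : V} (hu : γ u ≠ u) :
    ∃ z, G.Adj u z ∧ γ z = γ u ∧ G.dist (γ u) z < G.dist (γ u) u := by
  obtain ⟨z, hz, hlt⟩ := exists_adj_dist_lt hG.preconnected hu.symm
  exact ⟨z, hz, ((h.edge_gate hz).resolve_right fun e => hu e.1).symm, hlt⟩

theorem dist_le_of_walk (h : GatedCycle G ℓ r γ) (hG : G.Connected) (i k : ℕ) :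
    G.dist (r i) (r (i + k)) ≤ k := by
  induction k with
  | zero => simp
  | succ k ih =>
    have h1 := hG.dist_triangle (u := r i) (v := r (i + k)) (w := r (i + (k + 1)))
    have h2 : G.dist (r (i + k)) (r (i + (k + 1))) = 1 :=
      SimpleGraph.dist_eq_one_iff_adj.2 (h.adj (i + k))
    omega

theorem dist_le (h : GatedCycle G ℓ r γ) (hG : G.Connected) {i j : ℕ} (hi : i < ℓ) (hj : j < ℓ) :
    (G.dist (r i) (r j) : ℤ) ≤
      min (((i : ℤ) - j).natAbs : ℤ) (ℓ - (((i : ℤ) - j).natAbs : ℤ)) := by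
  wlog hij : i ≤ j generalizing i j
  · have := this hj hi (by omega)
    rw [G.dist_comm]
    omega
  have h1 := h.dist_le_of_walk hG i (j - i)
  have h2 := h.dist_le_of_walk hG j (i + ℓ - j)
  rw [show i + (j - i) = j by omega] at h1
  rw [show j + (i + ℓ - j) = i + ℓ * 1 by omega, h.add_period, G.dist_comm] at h2
  omega

end GatedCycle

section Unfold

variable {V : Type*}

/-- Replace the cycle by a path: `p u` is the position on the path of the gate of `u`. -/
def unfoldCycle (G : SimpleGraph V) (γ : V → V) (p : V → ℕ) : SimpleGraph V where
  Adj u v := (G.Adj u v ∧ γ u = γ v) ∨ (γ u = u ∧ γ v = v ∧ (p u + 1 = p v ∨ p v + 1 = p u))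
  symm := ⟨by
    rintro u v (⟨h1, h2⟩ | ⟨h1, h2, h3⟩)
    · exact Or.inl ⟨h1.symm, h2.symm⟩
    · exact Or.inr ⟨h2, h1, h3.symm⟩⟩
  loopless := ⟨by
    rintro u (⟨h1, -⟩ | ⟨-, -, h3⟩)
    · exact G.loopless.irrefl u h1
    · omega⟩

variable {G : SimpleGraph V} {ℓ : ℕ} {r : ℕ → V} {γ : V → V}

theorem unfoldCycle_connected (h : GatedCycle G ℓ r γ) (hG : G.Connected) {p : V → ℕ}
    {a : ℕ → V} (ha : ∀ k < ℓ, γ (a k) = a k ∧ p (a k) = k) (hpa : ∀ u, p u < ℓ ∧ a (p u) = γ u) :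
    (unfoldCycle G γ p).Connected := by
  have h1 : ∀ n u, G.dist (γ u) u = n → (unfoldCycle G γ p).Reachable u (γ u) := by
    intro n
    induction n using Nat.strong_induction_on with
    | _ n ih =>
      intro u hu
      by_cases hγ : γ u = u
      · rw [hγ]
      obtain ⟨z, hz, hγz, hlt⟩ := h.exists_parent hG hγ
      have h2 := ih _ (hu ▸ hlt) z (by rw [hγz])
      rw [hγz] at h2
      exact (SimpleGraph.Adj.reachable (Or.inl ⟨hz, hγz.symm⟩)).trans h2
  have h2 : ∀ k < ℓ, (unfoldCycle G γ p).Reachable (a 0) (a k) := by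
    intro k
    induction k with
    | zero => exact fun _ => SimpleGraph.Reachable.refl _
    | succ k ih =>
      intro hk
      refine (ih (by omega)).trans (SimpleGraph.Adj.reachable (Or.inr
        ⟨(ha k (by omega)).1, (ha (k + 1) hk).1, Or.inl ?_⟩))
      rw [(ha k (by omega)).2, (ha (k + 1) hk).2]
  have h3 : ∀ u, (unfoldCycle G γ p).Reachable (a 0) u := fun u => by
    have := h2 (p u) (hpa u).1
    rw [(hpa u).2] at this
    exact this.trans (h1 _ u rfl).symm
  have : Nonempty V := hG.nonempty
  exact ⟨fun u v => (h3 u).symm.trans (h3 v)⟩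

open Classical in
-- As a function of `v`, the left side vanishes at `u` and grows by at most one along each edge of
-- the unfolded graph, so it is bounded by the length of any walk from `u`.
theorem le_dist_unfoldCycle (hG : G.Connected) {p : V → ℕ} (hp : ∀ u v, γ u = γ v → p u = p v)
    (hU : (unfoldCycle G γ p).Connected) (u v : V) :
    (if γ u = γ v then G.dist u v else
      G.dist u (γ u) + ((p u : ℤ) - p v).natAbs + G.dist (γ v) v) ≤
      (unfoldCycle G γ p).dist u v := by
  set D : V → ℕ := fun v => if γ u = γ v then G.dist u v else
      G.dist u (γ u) + ((p u : ℤ) - p v).natAbs + G.dist (γ v) v with hD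
  have hlip : ∀ v v', (unfoldCycle G γ p).Adj v v' → D v' ≤ D v + 1 := by
    rintro v v' (⟨h1, h2⟩ | ⟨h1, h2, h3⟩)
    · have e : G.dist v v' = 1 := SimpleGraph.dist_eq_one_iff_adj.2 h1
      have t1 := hG.dist_triangle (u := u) (v := v) (w := v')
      have t2 := hG.dist_triangle (u := γ v) (v := v) (w := v')
      simp only [hD, ← h2, ← hp v v' h2]
      split_ifs <;> omega
    · simp only [hD, h1, h2, SimpleGraph.dist_self]
      by_cases e : γ u = v <;> by_cases e' : γ u = v'
      · have hvv : v = v' := e.symm.trans e'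
        subst hvv
        omega
      · have := hp u v (by rw [e, h1])
        rw [if_neg e', if_pos e, e]
        omega
      · have := hp u v' (by rw [e', h2])
        rw [if_pos e', if_neg e, e']
        omega
      · rw [if_neg e, if_neg e']
        omega
  have hw : ∀ a b (w : (unfoldCycle G γ p).Walk a b), D b ≤ D a + w.length := by
    intro a b w
    induction w with
    | nil => simp
    | cons hab w ih =>
      have := hlip _ _ hab
      rw [SimpleGraph.Walk.length_cons]
      omega
  obtain ⟨w, hwl⟩ := (hU.preconnected u v).exists_walk_length_eq_dist
  have := hw u v w
  rw [hwl] at this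
  simpa [hD] using this

end Unfold

/-! ### Distances on a cycle against the four unfolded orders. -/

section Arithmetic

/-- Half of the total gain in the distance between the `i`-th and the `j`-th vertex of a cycle of
length `ℓ` when the cycle is unfolded in the four ways `unfoldPos ℓ`. -/
def unfoldGain (ℓ i j : ℕ) : ℤ :=
  2 * (if i = 0 ∧ j ≠ 0 then 1 else 0) + (if i = 0 ∧ 2 * j = ℓ + 2 then 1 else 0) +
    (if i = 0 ∧ 2 * j + 2 = ℓ then 1 else 0) - (if i = 1 ∧ 2 * j = ℓ + 2 then 1 else 0) -
    (if i + 1 = ℓ ∧ 2 * j + 2 = ℓ then 1 else 0)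

/-- Four ways to arrange the vertices of a cycle of length `ℓ` on a path that starts at the
vertex `0`: in order, in reverse order, and the two variants of these in which the last vertex is
moved next to the vertex `0`. -/
def unfoldPos (ℓ : ℕ) : Fin 4 → ℕ → ℕ
  | 0, i => i
  | 1, i => if i = 0 then 0 else ℓ - i
  | 2, i => if i = 0 then 0 else if i = 1 then 1 else ℓ - i + 1
  | 3, i => if i = 0 then 0 else if i + 1 = ℓ then 1 else i + 1

theorem unfoldPos_lt {ℓ : ℕ} (hℓ : 3 ≤ ℓ) (q : Fin 4) {i : ℕ} (hi : i < ℓ) :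
    unfoldPos ℓ q i < ℓ := by
  fin_cases q <;> simp only [unfoldPos] <;> (try split_ifs) <;> omega

theorem unfoldPos_inj {ℓ : ℕ} (q : Fin 4) {i j : ℕ} (hi : i < ℓ) (hj : j < ℓ)
    (h : unfoldPos ℓ q i = unfoldPos ℓ q j) : i = j := by
  fin_cases q <;> simp only [unfoldPos] at h <;> (try split_ifs at h) <;> omega

theorem unfoldPos_surj {ℓ : ℕ} (hℓ : 3 ≤ ℓ) (q : Fin 4) :
    ∃ a : ℕ → ℕ, (∀ k < ℓ, a k < ℓ ∧ unfoldPos ℓ q (a k) = k) ∧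
      ∀ i < ℓ, a (unfoldPos ℓ q i) = i := by
  let f : Fin ℓ → Fin ℓ := fun i => ⟨unfoldPos ℓ q i, unfoldPos_lt hℓ q i.2⟩
  have hf : Function.Injective f := fun i j h =>
    Fin.ext (unfoldPos_inj q i.2 j.2 (congrArg Fin.val h))
  have hs := Finite.surjective_of_injective hf
  have hk : ∀ k, ∃ i, k < ℓ → i < ℓ ∧ unfoldPos ℓ q i = k := fun k => by
    by_cases hk : k < ℓ
    · obtain ⟨i, hi⟩ := hs ⟨k, hk⟩
      exact ⟨i, fun _ => ⟨i.2, congrArg Fin.val hi⟩⟩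
    · exact ⟨0, fun h => absurd h hk⟩
  choose a ha using hk
  refine ⟨a, ha, fun i hi => ?_⟩
  obtain ⟨h1, h2⟩ := ha _ (unfoldPos_lt hℓ q hi)
  exact unfoldPos_inj q h1 hi h2

theorem unfoldGain_of_lt {ℓ i j : ℕ} (hij : i < j) (hj : j < ℓ) :
    unfoldGain ℓ j i = - (if j + 1 = ℓ ∧ 2 * i + 2 = ℓ then 1 else 0) := by
  unfold unfoldGain
  rw [if_neg (by omega), if_neg (by omega), if_neg (by omega), if_neg (by omega)]
  ring

/-- Pairs containing `0` gain in total. Among the others, only `1` and its antipode (`2 * j = ℓ +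
2`) or `ℓ - 1` and its antipode (`2 * i + 2 = ℓ`) can lose, one unit for each. The pairs of `0` with
these same antipodes have extra gain, which is recorded for later compensation. -/
theorem sum_unfoldPos_ge_of_lt {ℓ i j : ℕ} (hℓ : 3 ≤ ℓ) (hij : i < j) (hj : j < ℓ) :
    4 * min ((j : ℤ) - i) (ℓ - ((j : ℤ) - i)) + unfoldGain ℓ i j + unfoldGain ℓ j i ≤
      ∑ q, |(unfoldPos ℓ q i : ℤ) - unfoldPos ℓ q j| := by
  rw [unfoldGain_of_lt hij hj]
  simp only [Fin.sum_univ_four, unfoldPos, unfoldGain]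
  rw [if_neg (show ¬ (i + 1 = ℓ ∧ 2 * j + 2 = ℓ) by omega), if_neg (show ¬ j = 0 by omega),
    if_neg (show ¬ i + 1 = ℓ by omega)]
  simp only [if_neg (show ¬ j = 0 by omega), show ((i : ℤ) - j) = - ((j : ℤ) - i) by ring, abs_neg]
  rw [abs_of_nonneg (show (0 : ℤ) ≤ (j : ℤ) - i by omega)]
  rcases Nat.lt_or_ge i 1 with h0 | h0
  · have h0 : i = 0 := by omega
    subst h0
    rw [if_neg (show ¬ (0 = 1 ∧ 2 * j = ℓ + 2) by omega), if_pos (show 0 = 0 ∧ j ≠ 0 by omega)]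
    simp only [if_true, true_and]
    split_ifs <;> push_cast [Nat.cast_sub hj.le] <;>
      (try rw [abs_of_nonpos (by omega)]) <;> (try rw [abs_of_nonpos (by omega)]) <;>
      (try rw [abs_of_nonpos (by omega)]) <;> omega
  · rw [if_neg (show ¬ (i = 0 ∧ j ≠ 0) by omega),
      if_neg (show ¬ (i = 0 ∧ 2 * j = ℓ + 2) by omega),
      if_neg (show ¬ (i = 0 ∧ 2 * j + 2 = ℓ) by omega)]
    simp only [if_neg (show ¬ i = 0 by omega)]
    have hA : |((ℓ - i : ℕ) : ℤ) - (ℓ - j : ℕ)| = (j : ℤ) - i := by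
      rw [abs_of_nonneg (by omega)]; omega
    rw [hA]
    rcases Nat.lt_or_ge i 2 with h1 | h1
    · have h1 : i = 1 := by omega
      subst h1
      rw [if_neg (show ¬ j = 1 by omega)]
      simp only [if_true, true_and]
      have hB : |((1 : ℕ) : ℤ) - (ℓ - j + 1 : ℕ)| = (ℓ : ℤ) - j := by
        rw [abs_of_nonpos (by omega)]; omega
      rw [hB]
      by_cases hl : j + 1 = ℓ
      · simp only [hl, true_and]
        norm_num
        split_ifs <;> omega
      · simp only [hl, false_and, if_false]
        have hC : |((1 + 1 : ℕ) : ℤ) - (j + 1 : ℕ)| = (j : ℤ) - 1 := by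
          rw [abs_of_nonpos (by omega)]; omega
        rw [hC]
        split_ifs <;> omega
    · simp only [if_neg (show ¬ i = 1 by omega), if_neg (show ¬ j = 1 by omega),
        if_neg (show ¬ (i = 1 ∧ 2 * j = ℓ + 2) by omega)]
      have hB : |((ℓ - i + 1 : ℕ) : ℤ) - (ℓ - j + 1 : ℕ)| = (j : ℤ) - i := by
        rw [abs_of_nonneg (by omega)]; omega
      rw [hB]
      by_cases hl : j + 1 = ℓ
      · simp only [hl, true_and, if_true]
        have hC : |((i + 1 : ℕ) : ℤ) - (1 : ℕ)| = (i : ℤ) := by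
          rw [abs_of_nonneg (by omega)]; omega
        rw [hC]
        split_ifs <;> omega
      · simp only [hl, false_and, if_false]
        have hC : |((i + 1 : ℕ) : ℤ) - (j + 1 : ℕ)| = (j : ℤ) - i := by
          rw [abs_of_nonpos (by omega)]; omega
        rw [hC]
        omega

theorem sum_unfoldPos_ge {ℓ i j : ℕ} (hℓ : 3 ≤ ℓ) (hi : i < ℓ) (hj : j < ℓ) :
    4 * min (((i : ℤ) - j).natAbs : ℤ) (ℓ - (((i : ℤ) - j).natAbs : ℤ)) +
      unfoldGain ℓ i j + unfoldGain ℓ j i ≤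
      ∑ q, |(unfoldPos ℓ q i : ℤ) - unfoldPos ℓ q j| := by
  rcases Nat.lt_trichotomy i j with h | h | h
  · have := sum_unfoldPos_ge_of_lt hℓ h hj
    rwa [show (((i : ℤ) - j).natAbs : ℤ) = (j : ℤ) - i by omega]
  · subst h
    have : unfoldGain ℓ i i = 0 := by
      unfold unfoldGain
      rw [if_neg (by omega), if_neg (by omega), if_neg (by omega), if_neg (by omega),
        if_neg (by omega)]
      ring
    simp [this]
  · have := sum_unfoldPos_ge_of_lt hℓ h hi
    rw [show (((i : ℤ) - j).natAbs : ℤ) = (i : ℤ) - j by omega]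
    simp only [abs_sub_comm (unfoldPos ℓ _ i : ℤ)]
    linarith

end Arithmetic

/-! ### The weighted gain from unfolding one or two cycles. -/

section Gain

variable {V : Type*} [Fintype V] {G : SimpleGraph V} {ℓ : ℕ} {r : ℕ → V} {γ : V → V}

/-- The negative terms pair the piles at `1` and `ℓ - 1` with their antipodes. The pile at `0` is at
least as heavy as either, so its extra terms with the same antipodes absorb them and the main term
remains. -/
theorem sum_sum_unfoldGain {idx : V → ℕ} {y : V → ℝ} (hidx : ∀ u, idx u < ℓ) (hy : ∀ u, 0 ≤ y u)
    {B : ℕ → ℝ} (hB : ∀ j, B j = ∑ u with idx u = j, y u) (hmax : ∀ j, B j ≤ B 0) :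
    2 * (B 0 * (∑ u, y u - B 0)) ≤ ∑ u, ∑ v, y u * y v * (unfoldGain ℓ (idx u) (idx v) : ℝ) := by
  set e : (ℕ → Prop) → V → ℝ := fun P u => open Classical in if P (idx u) then y u else 0 with he
  have hgain : ∀ u v, y u * y v * (unfoldGain ℓ (idx u) (idx v) : ℝ) =
      2 * (e (· = 0) u * e (· ≠ 0) v) + e (· = 0) u * e (2 * · = ℓ + 2) v +
        e (· = 0) u * e (2 * · + 2 = ℓ) v - e (· = 1) u * e (2 * · = ℓ + 2) v -
        e (· + 1 = ℓ) u * e (2 * · + 2 = ℓ) v := by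
    intro u v
    have hite : ∀ P Q : Prop, ∀ [Decidable P] [Decidable Q] [Decidable (P ∧ Q)],
        y u * y v * (((if P ∧ Q then 1 else 0 : ℤ)) : ℝ) =
          (if P then y u else 0) * (if Q then y v else 0) := by
      intro P Q _ _ _
      by_cases hP : P <;> by_cases hQ : Q <;> simp [hP, hQ]
    simp only [he, unfoldGain, ← hite]
    push_cast
    ring
  have hnn : ∀ P, 0 ≤ ∑ u, e P u := fun P => Finset.sum_nonneg fun u _ => by
    simp only [he]
    split_ifs <;> simp [hy]
  have hBj : ∀ j, ∑ u, e (· = j) u = B j := fun j => by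
    rw [hB, Finset.sum_filter]
    refine Finset.sum_congr rfl fun u _ => ?_
    by_cases h : idx u = j <;> simp [he, h]
  have hl : ∑ u, e (· + 1 = ℓ) u ≤ B 0 := by
    refine le_trans (le_of_eq ?_) (hmax (ℓ - 1))
    rw [← hBj]
    refine Finset.sum_congr rfl fun u _ => ?_
    have := hidx u
    have h2 : (idx u + 1 = ℓ) ↔ (idx u = ℓ - 1) := by omega
    by_cases h : idx u = ℓ - 1
    · simp only [he, if_pos h, if_pos (h2.2 h)]
    · simp only [he, if_neg h, if_neg (mt h2.1 h)]
  have hne : ∑ u, e (· ≠ 0) u = ∑ u, y u - B 0 := by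
    rw [← hBj, ← Finset.sum_sub_distrib]
    refine Finset.sum_congr rfl fun u _ => ?_
    simp only [he]
    by_cases h : idx u = 0 <;> simp [h]
  simp_rw [hgain, Finset.sum_sub_distrib, Finset.sum_add_distrib, ← Finset.mul_sum, ← Finset.sum_mul]
  rw [hBj, hBj, hne]
  have h1 := mul_le_mul_of_nonneg_right (hmax 1) (hnn (2 * · = ℓ + 2))
  have h2 := mul_le_mul_of_nonneg_right hl (hnn (2 * · + 2 = ℓ))
  linarith

variable [DecidableEq V]

/-- A cycle can be replaced by a path through its vertices in such a way that the distance form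
increases by at least `B * (S - B)`, where `B` is the largest weight hanging at a vertex of the
cycle and `S` is the total weight. -/
theorem GatedCycle.exists_unfold (h : GatedCycle G ℓ r γ) (hG : G.Connected) {y : V → ℝ}
    (hy : ∀ u, 0 ≤ y u)
    (hmax : ∀ j, ∑ u with γ u = r j, y u ≤ ∑ u with γ u = r 0, y u) :
    ∃ G' : SimpleGraph V, G'.Connected ∧
      (∀ u v, G'.Adj u v → G.Adj u v ∨ (γ u = u ∧ γ v = v)) ∧
      (∀ u v, G.Adj u v → γ u = γ v → G'.Adj u v) ∧
      distForm G y + (∑ u with γ u = r 0, y u) * (∑ u, y u - ∑ u with γ u = r 0, y u) ≤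
        distForm G' y := by
  obtain ⟨idx, hidx⟩ := h.exists_index
  have hℓ := h.three_le
  have hidx_eq : ∀ u v, γ u = γ v → idx u = idx v := fun u v e => by
    rw [← (hidx u).2, ← (hidx v).2, h.eq_iff, Nat.mod_eq_of_lt (hidx u).1,
      Nat.mod_eq_of_lt (hidx v).1] at e
    exact e
  have hidx_r : ∀ j < ℓ, idx (r j) = j := fun j hj => by
    have := (hidx (r j)).2
    rw [h.gate_self, h.eq_iff, Nat.mod_eq_of_lt (hidx _).1, Nat.mod_eq_of_lt hj] at this
    exact this
  set G' : Fin 4 → SimpleGraph V := fun q => unfoldCycle G γ fun u => unfoldPos ℓ q (idx u)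
    with hG'
  have hconn : ∀ q, (G' q).Connected := fun q => by
    obtain ⟨a, ha1, ha2⟩ := unfoldPos_surj hℓ q
    refine unfoldCycle_connected h hG (a := fun k => r (a k)) (fun k hk => ⟨h.gate_self _, ?_⟩)
      fun u => ⟨unfoldPos_lt hℓ q (hidx u).1, ?_⟩
    · rw [hidx_r _ (ha1 k hk).1, (ha1 k hk).2]
    · rw [ha2 _ (hidx u).1, (hidx u).2]
  set dC : V → V → ℤ := fun u v => min (((idx u : ℤ) - idx v).natAbs : ℤ)
    (ℓ - (((idx u : ℤ) - idx v).natAbs : ℤ)) with hdC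
  have hdist : ∀ q u v, (G.dist u v : ℤ) +
      (|(unfoldPos ℓ q (idx u) : ℤ) - unfoldPos ℓ q (idx v)| - dC u v) ≤ (G' q).dist u v := by
    intro q u v
    have h1 := le_dist_unfoldCycle (γ := γ) (p := fun u => unfoldPos ℓ q (idx u)) hG
      (fun u v e => by rw [hidx_eq u v e]) (hconn q) u v
    by_cases e : γ u = γ v
    · rw [if_pos e] at h1
      simp only [hdC, hidx_eq u v e, sub_self, abs_zero, Int.natAbs_zero]
      have : (0 : ℤ) ≤ min (0 : ℤ) (ℓ - 0) := by omega
      simp only [hG']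
      push_cast
      omega
    · rw [if_neg e] at h1
      have h2 := hG.dist_triangle (u := u) (v := γ u) (w := v)
      have h3 := hG.dist_triangle (u := γ u) (v := γ v) (w := v)
      have h4 := h.dist_le hG (hidx u).1 (hidx v).1
      rw [(hidx u).2, (hidx v).2] at h4
      simp only [hdC, hG']
      rw [Int.abs_eq_natAbs]
      omega
  set S := ∑ u, y u with hS
  set B : ℕ → ℝ := fun j => ∑ u with idx u = j, y u with hB
  have hBr : ∀ j < ℓ, ∑ u with γ u = r j, y u = B j := fun j hj => by
    refine Finset.sum_congr (Finset.filter_congr fun u _ => ?_) fun _ _ => rfl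
    rw [← (hidx u).2, h.eq_iff, Nat.mod_eq_of_lt (hidx u).1, Nat.mod_eq_of_lt hj]
  have hB0 : ∀ j, B j ≤ B 0 := fun j => by
    rcases lt_or_ge j ℓ with hj | hj
    · rw [← hBr j hj, ← hBr 0 (by omega)]
      exact hmax j
    · have : B j = 0 := by
        refine Finset.sum_eq_zero fun u hu => ?_
        have := (Finset.mem_filter.1 hu).2
        have := (hidx u).1
        omega
      rw [this]
      exact Finset.sum_nonneg fun u _ => hy u
  have hgain := sum_sum_unfoldGain (ℓ := ℓ) (idx := idx) (fun u => (hidx u).1) hy (fun _ => rfl)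
    hB0
  have hswap : ∑ u, ∑ v, y u * y v * (unfoldGain ℓ (idx v) (idx u) : ℝ) =
      ∑ u, ∑ v, y u * y v * (unfoldGain ℓ (idx u) (idx v) : ℝ) := by
    rw [Finset.sum_comm]
    exact Finset.sum_congr rfl fun u _ => Finset.sum_congr rfl fun v _ => by ring
  have htot : 4 * distForm G y + 4 * (B 0 * (S - B 0)) ≤ ∑ q, distForm (G' q) y := by
    have hpt : ∀ u v, y u * y v * (4 * (G.dist u v : ℝ) + unfoldGain ℓ (idx u) (idx v) +
        unfoldGain ℓ (idx v) (idx u)) ≤ ∑ q, y u * y v * ((G' q).dist u v : ℝ) := by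
      intro u v
      rw [← Finset.mul_sum]
      refine mul_le_mul_of_nonneg_left ?_ (mul_nonneg (hy u) (hy v))
      have h1 := sum_unfoldPos_ge hℓ (hidx u).1 (hidx v).1
      have h2 := Finset.sum_le_sum fun q (_ : q ∈ Finset.univ) => hdist q u v
      rw [Finset.sum_add_distrib, Finset.sum_sub_distrib] at h2
      simp only [Finset.sum_const, Finset.card_univ, Fintype.card_fin, nsmul_eq_mul] at h2
      have h3 : 4 * (G.dist u v : ℤ) + unfoldGain ℓ (idx u) (idx v) +
          unfoldGain ℓ (idx v) (idx u) ≤ ∑ q, ((G' q).dist u v : ℤ) := by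
        push_cast at h2
        linarith
      exact_mod_cast h3
    have h1 : ∑ q, distForm (G' q) y = ∑ u, ∑ v, ∑ q, y u * y v * ((G' q).dist u v : ℝ) := by
      unfold distForm
      rw [Finset.sum_comm]
      exact Finset.sum_congr rfl fun u _ => Finset.sum_comm
    rw [h1]
    refine le_trans ?_ (Finset.sum_le_sum fun u _ => Finset.sum_le_sum fun v _ => hpt u v)
    simp_rw [mul_add, Finset.sum_add_distrib]
    rw [hswap]
    have h2 : ∑ u, ∑ v, y u * y v * (4 * (G.dist u v : ℝ)) = 4 * distForm G y := by
      unfold distForm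
      simp_rw [Finset.mul_sum]
      exact Finset.sum_congr rfl fun u _ => Finset.sum_congr rfl fun v _ => by ring
    rw [h2]
    linarith
  -- The four unfoldings together achieve four times the required gain, so one of them achieves it.
  obtain ⟨q, hq⟩ : ∃ q, distForm G y + B 0 * (S - B 0) ≤ distForm (G' q) y := by
    by_contra! hcon
    have := Finset.sum_lt_sum_of_nonempty Finset.univ_nonempty fun q (_ : q ∈ Finset.univ) => hcon q
    simp only [Finset.sum_const, Finset.card_univ, Fintype.card_fin, nsmul_eq_mul] at this
    push_cast at this
    linarith
  refine ⟨G' q, hconn q, ?_, fun u v huv e => Or.inl ⟨huv, e⟩, ?_⟩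
  · rintro u v (⟨h1, -⟩ | ⟨h1, h2, -⟩)
    · exact Or.inl h1
    · exact Or.inr ⟨h1, h2⟩
  · rw [hBr 0 (by omega)]
    exact hq

theorem GatedCycle.exists_max (h : GatedCycle G ℓ r γ) (y : V → ℝ) :
    ∃ k, ∀ j, ∑ u with γ u = r j, y u ≤ ∑ u with γ u = r k, y u := by
  have hpos : 0 < ℓ := by have := h.three_le; omega
  obtain ⟨k, -, hk⟩ := (Finset.range ℓ).exists_max_image (fun j => ∑ u with γ u = r j, y u)
    ⟨0, Finset.mem_range.2 hpos⟩
  refine ⟨k, fun j => ?_⟩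
  have := hk (j % ℓ) (Finset.mem_range.2 (Nat.mod_lt _ hpos))
  rwa [(h.eq_iff (j % ℓ) j).2 (Nat.mod_mod _ _)] at this

/-- If a connected graph has two gated cycles, each hanging at a single vertex of the other, then
the distance form is smaller than the one of a path by a definite amount. -/
theorem exists_path_order_of_two_cycles (hG : G.Connected) {ℓ' : ℕ} {r' : ℕ → V} {γ' : V → V}
    (h : GatedCycle G ℓ r γ) (h' : GatedCycle G ℓ' r' γ')
    (hr : ∀ i j, γ' (r i) = γ' (r j)) (hr' : ∀ i j, γ (r' i) = γ (r' j))
    {y : V → ℝ} (hy : ∀ u, 0 ≤ y u) {β : ℝ}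
    (hβ : ∀ k, (∀ j, ∑ u with γ u = r j, y u ≤ ∑ u with γ u = r k, y u) →
      β ≤ (∑ u with γ u = r k, y u) * (∑ u, y u - ∑ u with γ u = r k, y u))
    (hβ' : ∀ k, (∀ j, ∑ u with γ' u = r' j, y u ≤ ∑ u with γ' u = r' k, y u) →
      β ≤ (∑ u with γ' u = r' k, y u) * (∑ u, y u - ∑ u with γ' u = r' k, y u)) :
    ∃ t : V → ℕ, (∀ v, t v < Fintype.card V) ∧ Function.Injective t ∧
      distForm G y + 2 * β ≤ ∑ u, ∑ v, y u * y v * |(t u : ℝ) - t v| := by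
  obtain ⟨k, hk⟩ := h.exists_max y
  obtain ⟨k', hk'⟩ := h'.exists_max y
  obtain ⟨G₁, hG₁, hsub, hsup, hle⟩ := (h.rotate k).exists_unfold hG hy (fun j => by
    simpa using hk (j + k))
  simp only [zero_add] at hle
  have hγr : ∀ u, γ u = u → ∃ i, u = r i := fun u hu => by
    obtain ⟨i, hi⟩ := h.gate_mem u
    exact ⟨i, hu ▸ hi⟩
  -- The second cycle stays gated: its edges lie in one pile of the first cycle and survive, and
  -- every new edge joins vertices of the first cycle, which share a gate on the second.
  have h₁ : GatedCycle G₁ ℓ' r' γ' :=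
    ⟨h'.three_le, h'.eq_iff, fun j => hsup _ _ (h'.adj j) (hr' _ _), h'.gate_mem, h'.gate_self,
      fun u v huv => by
        rcases hsub u v huv with e | ⟨e1, e2⟩
        · exact h'.edge u v e
        · obtain ⟨i, rfl⟩ := hγr u e1
          obtain ⟨j, rfl⟩ := hγr v e2
          exact Or.inl (hr i j)⟩
  obtain ⟨G₂, hG₂, -, -, hle₂⟩ := (h₁.rotate k').exists_unfold hG₁ hy (fun j => by
    simpa using hk' (j + k'))
  simp only [zero_add] at hle₂
  obtain ⟨t, ht, hinj, hle₃⟩ := exists_path_order hG₂ hy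
  refine ⟨t, ht, hinj, ?_⟩
  have := hβ k hk
  have := hβ' k' hk'
  linarith

end Gain

end DistSpec

/-! ### From three cactus-type cycles to three gated cycles. -/

namespace DistSpec

section Structure

variable {V : Type*}

/-- A cycle such that every cycle sharing an edge with it contains all its edges is gated. -/
theorem exists_gatedCycle {G : SimpleGraph V} (hG : G.Connected) {v₀ : V} {p : G.Walk v₀ v₀}
    (hp : p.IsCycle)
    (hu : ∀ u (q : G.Walk u u), q.IsCycle → ∀ e ∈ q.edges, e ∈ p.edges →
      ∀ e' ∈ p.edges, e' ∈ q.edges) :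
    ∃ γ, GatedCycle G p.length (fun j => p.getVert (j % p.length)) γ := by
  set ℓ := p.length with hℓdef
  set r : ℕ → V := fun j => p.getVert (j % ℓ) with hr
  have hℓ : 3 ≤ ℓ := hp.three_le_length
  have hlt : ∀ j, j % ℓ < ℓ := fun j => Nat.mod_lt _ (by omega)
  have hsucc : ∀ j, r (j + 1) = p.getVert (j % ℓ + 1) := fun j => by
    simp only [hr, Nat.add_mod j 1 ℓ, Nat.mod_eq_of_lt (show 1 < ℓ by omega)]
    have := hlt j
    rcases Nat.lt_or_ge (j % ℓ + 1) ℓ with h | h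
    · rw [Nat.mod_eq_of_lt h]
    · have h : j % ℓ + 1 = ℓ := by omega
      rw [h, Nat.mod_self, hℓdef, SimpleGraph.Walk.getVert_zero, SimpleGraph.Walk.getVert_length]
  have heq : ∀ i j, r i = r j ↔ i % ℓ = j % ℓ := fun i j => by
    refine ⟨fun h => ?_, fun h => by simp only [hr, h]⟩
    have h1 := hlt i
    have h2 := hlt j
    exact hp.getVert_injOn' (show i % ℓ ≤ ℓ - 1 by omega) (show j % ℓ ≤ ℓ - 1 by omega) h
  have hmem : ∀ j, s(r j, r (j + 1)) ∈ p.edges := fun j => by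
    rw [hsucc, p.mk_mem_edges_iff_exists]
    exact ⟨j % ℓ, hlt j, rfl⟩
  have hmem' : ∀ u v, s(u, v) ∈ p.edges → ∃ j, s(u, v) = s(r j, r (j + 1)) := fun u v h => by
    obtain ⟨i, hi, he⟩ := (p.mk_mem_edges_iff_exists).1 h
    refine ⟨i, ?_⟩
    rw [hsucc, Nat.mod_eq_of_lt hi, ← he]
    simp only [hr, Nat.mod_eq_of_lt (show i < ℓ from hi)]
  have hadj : ∀ j, G.Adj (r j) (r (j + 1)) := fun j => p.adj_of_mem_edges (hmem j)
  have hper : ∀ j, r (j + ℓ) = r j := fun j => (heq _ _).2 (Nat.add_mod_right j ℓ)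
  set F := G.deleteEdges {e | e ∈ p.edges} with hF
  -- If two cycle vertices were joined off the cycle, this connection and an arc of the cycle would
  -- close up to a cycle containing one cycle edge at `r j` and avoiding the other one, against
  -- `hu`. Hence the gate of a vertex is the unique cycle vertex in its component of `F`.
  have hsep : ∀ j i, 1 ≤ i → i < ℓ → ¬ F.Reachable (r j) (r (j + i)) := by
    intro j i hi1 hi hreach
    have hnej : ∀ i, 1 ≤ i → i < ℓ → r (j + i) ≠ r j := fun i hi1 hi h => by
      have h1 := (heq _ _).1 h
      have h2 : (j + i) ≡ (j + 0) [MOD ℓ] := h1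
      have h3 := Nat.ModEq.add_left_cancel' j h2
      rw [Nat.ModEq, Nat.mod_eq_of_lt hi, Nat.zero_mod] at h3
      omega
    set e := s(r j, r (j + 1)) with he
    set e' := s(r (j + ℓ - 1), r j) with he'
    have hj' : j + ℓ - 1 + 1 = j + ℓ := by omega
    have he'mem : e' ∈ p.edges := by
      have := hmem (j + ℓ - 1)
      rwa [hj', hper] at this
    have hee' : e ≠ e' := by
      intro h
      rcases Sym2.eq_iff.1 h with ⟨-, h2⟩ | ⟨-, h2⟩
      · exact hnej 1 le_rfl (by omega) h2
      · have h3 := (heq _ _).1 h2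
        rw [show j + ℓ - 1 = j + (ℓ - 1) by omega] at h3
        have h4 := Nat.ModEq.add_left_cancel' j (show j + 1 ≡ j + (ℓ - 1) [MOD ℓ] from h3)
        rw [Nat.ModEq, Nat.mod_eq_of_lt (by omega), Nat.mod_eq_of_lt (by omega)] at h4
        omega
    set F' := G.deleteEdges {e'} with hF'
    have hFF' : F ≤ F'.deleteEdges {e} := by
      intro a b hab
      rw [hF, SimpleGraph.deleteEdges_adj] at hab
      rw [SimpleGraph.deleteEdges_adj, hF', SimpleGraph.deleteEdges_adj]
      refine ⟨⟨hab.1, fun h => hab.2 ?_⟩, fun h => hab.2 ?_⟩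
      · rw [Set.mem_singleton_iff.1 h]; exact he'mem
      · rw [Set.mem_singleton_iff.1 h]; exact hmem j
    have hpath : ∀ k, k + 1 < ℓ → (F'.deleteEdges {e}).Reachable (r (j + 1)) (r (j + (k + 1))) := by
      intro k
      induction k with
      | zero => exact fun _ => SimpleGraph.Reachable.refl _
      | succ k ih =>
        intro hk
        refine (ih (by omega)).trans (SimpleGraph.Adj.reachable ?_)
        have n1 := hnej (k + 1) (by omega) (by omega)
        have n2 := hnej (k + 1 + 1) (by omega) hk
        rw [SimpleGraph.deleteEdges_adj, hF', SimpleGraph.deleteEdges_adj]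
        refine ⟨⟨hadj (j + (k + 1)), fun h => ?_⟩, fun h => ?_⟩
        · rcases Sym2.eq_iff.1 (Set.mem_singleton_iff.1 h) with ⟨-, h2⟩ | ⟨h1, -⟩
          · exact n2 h2
          · exact n1 h1
        · rcases Sym2.eq_iff.1 (Set.mem_singleton_iff.1 h) with ⟨h1, -⟩ | ⟨-, h2⟩
          · exact n1 h1
          · exact n2 h2
    have hreach' : (F'.deleteEdges {e}).Reachable (r j) (r (j + 1)) := by
      have h1 := hpath (i - 1) (by omega)
      rw [show i - 1 + 1 = i by omega] at h1
      exact (hreach.mono hFF').trans h1.symm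
    have hFadj : F'.Adj (r j) (r (j + 1)) := by
      rw [hF', SimpleGraph.deleteEdges_adj]
      exact ⟨hadj j, fun h => hee' (Set.mem_singleton_iff.1 h)⟩
    obtain ⟨u, q, hq, heq'⟩ :=
      SimpleGraph.adj_and_reachable_delete_edges_iff_exists_cycle.1 ⟨hFadj, hreach'⟩
    have hle : F' ≤ G := SimpleGraph.deleteEdges_le _
    have h1 := hu u (q.mapLe hle) (hq.mapLe hle) e
      (by rw [SimpleGraph.Walk.edges_mapLe_eq_edges]; exact heq') (hmem j) e' he'mem
    rw [SimpleGraph.Walk.edges_mapLe_eq_edges] at h1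
    have h2 := q.edges_subset_edgeSet h1
    rw [hF', SimpleGraph.edgeSet_deleteEdges] at h2
    exact h2.2 rfl
  have hsep' : ∀ i j, F.Reachable (r i) (r j) → r i = r j := by
    intro i j h
    have ei : r (i % ℓ) = r i := (heq _ _).2 (Nat.mod_mod _ _)
    have ej : r (j % ℓ) = r j := (heq _ _).2 (Nat.mod_mod _ _)
    have hi := hlt i
    have hj := hlt j
    rw [← ei, ← ej] at h ⊢
    rcases Nat.lt_trichotomy (i % ℓ) (j % ℓ) with hij | hij | hij
    · refine absurd h ?_
      have := hsep (i % ℓ) (j % ℓ - i % ℓ) (by omega) (by omega)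
      rwa [show i % ℓ + (j % ℓ - i % ℓ) = j % ℓ by omega] at this
    · rw [hij]
    · refine absurd h.symm ?_
      have := hsep (j % ℓ) (i % ℓ - j % ℓ) (by omega) (by omega)
      rwa [show j % ℓ + (i % ℓ - j % ℓ) = i % ℓ by omega] at this
  have hex : ∀ u, ∃ j, F.Reachable (r j) u := by
    have key : ∀ a u (w : G.Walk a u), (∃ j, F.Reachable (r j) a) → ∃ j, F.Reachable (r j) u := by
      intro a u w
      induction w with
      | nil => exact id
      | cons hab w ih =>
        rename_i a b c
        rintro ⟨j, hj⟩
        apply ih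
        by_cases hE : s(a, b) ∈ p.edges
        · obtain ⟨k, hk⟩ := hmem' a b hE
          rcases Sym2.eq_iff.1 hk with ⟨-, h2⟩ | ⟨-, h2⟩
          · exact ⟨k + 1, h2 ▸ SimpleGraph.Reachable.refl _⟩
          · exact ⟨k, h2 ▸ SimpleGraph.Reachable.refl _⟩
        · refine ⟨j, hj.trans (SimpleGraph.Adj.reachable ?_)⟩
          rw [hF, SimpleGraph.deleteEdges_adj]
          exact ⟨hab, hE⟩
    intro u
    obtain ⟨w⟩ := hG.preconnected (r 0) u
    exact key _ _ w ⟨0, SimpleGraph.Reachable.refl _⟩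
  choose g hg using hex
  refine ⟨fun u => r (g u), hℓ, heq, hadj, fun u => ⟨g u, rfl⟩, fun j => hsep' _ _ (hg (r j)),
    fun u v huv => ?_⟩
  by_cases hE : s(u, v) ∈ p.edges
  · exact Or.inr (hmem' u v hE)
  · refine Or.inl (hsep' _ _ ((hg u).trans (SimpleGraph.Reachable.trans
      (SimpleGraph.Adj.reachable ?_) (hg v).symm)))
    rw [hF, SimpleGraph.deleteEdges_adj]
    exact ⟨huv, hE⟩

theorem isCycleSubgraph_le_edgeInduced {G : SimpleGraph V} {C : G.Subgraph}
    (hC : IsCycleSubgraph C) {S : Set (Sym2 V)} (hS : C.edgeSet ⊆ S) : C ≤ edgeInduced G S := by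
  obtain ⟨v, p, hp, rfl⟩ := hC
  refine ⟨fun u hu => ?_, fun a b hab => ⟨hab.adj_sub, hS hab⟩⟩
  rw [SimpleGraph.Walk.mem_verts_toSubgraph,
    SimpleGraph.Walk.mem_support_iff_exists_mem_edges_of_not_nil hp.not_nil] at hu
  obtain ⟨e, he, hue⟩ := hu
  obtain ⟨w, rfl⟩ := Sym2.mem_iff_exists.1 hue
  exact ⟨w, p.adj_of_mem_edges he, hS (p.mem_edges_toSubgraph.2 he)⟩

theorem IsCycleSubgraph.edgeSet_nonempty {G : SimpleGraph V} {C : G.Subgraph}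
    (hC : IsCycleSubgraph C) : C.edgeSet.Nonempty := by
  obtain ⟨v, p, hp, rfl⟩ := hC
  obtain ⟨e, he, -⟩ := (SimpleGraph.Walk.mem_support_iff_exists_mem_edges_of_not_nil hp.not_nil).1
    p.start_mem_support
  exact ⟨e, p.mem_edges_toSubgraph.2 he⟩

/-- Disjoint nonempty edge sets make the three cycles distinct, so they exhaust a set of exactly
three. -/
theorem AreCactusTypeCycles.eq_of_le {G : SimpleGraph V} {G₁ G₂ G₃ : G.Subgraph}
    (h : AreCactusTypeCycles G₁ G₂ G₃) {C : G.Subgraph} (hC : IsCycleSubgraph C)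
    (hle : C.edgeSet ⊆ G₁.edgeSet ∪ G₂.edgeSet ∪ G₃.edgeSet) : C = G₁ ∨ C = G₂ ∨ C = G₃ := by
  obtain ⟨h1, h2, h3, h12, h13, h23, hcard⟩ := h
  have hne : ∀ {A B : G.Subgraph}, IsCycleSubgraph A → Disjoint A.edgeSet B.edgeSet → A ≠ B := by
    rintro A B hA hAB rfl
    exact hA.edgeSet_nonempty.ne_empty (disjoint_self.1 hAB)
  set T := {C : G.Subgraph | IsCycleSubgraph C ∧
    C ≤ edgeInduced G (G₁.edgeSet ∪ G₂.edgeSet ∪ G₃.edgeSet)} with hT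
  have hsub : ({G₁, G₂, G₃} : Set G.Subgraph) ⊆ T := by
    rintro A (rfl | rfl | rfl)
    · exact ⟨h1, isCycleSubgraph_le_edgeInduced h1 fun e he => Or.inl (Or.inl he)⟩
    · exact ⟨h2, isCycleSubgraph_le_edgeInduced h2 fun e he => Or.inl (Or.inr he)⟩
    · exact ⟨h3, isCycleSubgraph_le_edgeInduced h3 fun e he => Or.inr he⟩
  have hc3 : ({G₁, G₂, G₃} : Set G.Subgraph).encard = 3 :=
    Set.encard_eq_three.2 ⟨_, _, _, hne h1 h12, hne h1 h13, hne h2 h23, rfl⟩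
  have heq : ({G₁, G₂, G₃} : Set G.Subgraph) = T :=
    (Set.toFinite _).eq_of_subset_of_encard_le hsub (by rw [hc3, hcard])
  have : C ∈ ({G₁, G₂, G₃} : Set G.Subgraph) := by
    rw [heq]
    exact ⟨hC, isCycleSubgraph_le_edgeInduced hC hle⟩
  simpa using this

/-- A connected graph with three cactus-type cycles has a connected spanning subgraph in which
these cycles are gated, and each of them hangs at a single vertex of each other one. -/
theorem exists_three_gatedCycles [Finite V] {G : SimpleGraph V} (hG : G.Connected)
    {G₁ G₂ G₃ : G.Subgraph} (h : AreCactusTypeCycles G₁ G₂ G₃) :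
    ∃ G₀ ≤ G, G₀.Connected ∧ ∃ (ℓ : Fin 3 → ℕ) (r : Fin 3 → ℕ → V) (γ : Fin 3 → V → V),
      (∀ i, GatedCycle G₀ (ℓ i) (r i) (γ i)) ∧
        ∀ i j, i ≠ j → ∀ a b, γ i (r j a) = γ i (r j b) := by
  set C : Fin 3 → G.Subgraph := ![G₁, G₂, G₃] with hCdef
  set H : Set (Sym2 V) := G₁.edgeSet ∪ G₂.edgeSet ∪ G₃.edgeSet with hH
  have hCH : ∀ i, (C i).edgeSet ⊆ H := by
    intro i
    fin_cases i
    · exact fun e he => Or.inl (Or.inl he)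
    · exact fun e he => Or.inl (Or.inr he)
    · exact fun e he => Or.inr he
  have hcyc : ∀ i, IsCycleSubgraph (C i) := by
    intro i
    fin_cases i
    · exact h.1
    · exact h.2.1
    · exact h.2.2.1
  have hdisj : ∀ i j, i ≠ j → Disjoint (C i).edgeSet (C j).edgeSet := by
    obtain ⟨-, -, -, h12, h13, h23, -⟩ := h
    intro i j hij
    fin_cases i <;> fin_cases j <;> first
      | exact absurd rfl hij
      | assumption
      | exact h12
      | exact h13
      | exact h23
      | exact h12.symm
      | exact h13.symm
      | exact h23.symm
  have heq : ∀ D : G.Subgraph, IsCycleSubgraph D → D.edgeSet ⊆ H → ∃ i, D = C i := by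
    intro D hD hDH
    rcases h.eq_of_le hD hDH with e | e | e
    · exact ⟨0, e⟩
    · exact ⟨1, e⟩
    · exact ⟨2, e⟩
  have hHG : H ⊆ G.edgeSet := by
    rintro e ((he | he) | he) <;> exact SimpleGraph.Subgraph.edgeSet_subset _ he
  obtain ⟨G₀, hmin⟩ := (Set.toFinite {G' : SimpleGraph V | G' ≤ G ∧ H ⊆ G'.edgeSet ∧
    G'.Connected}).exists_minimal ⟨G, le_rfl, hHG, hG⟩
  obtain ⟨hle, hH₀, hconn⟩ := hmin.prop
  -- A non-bridge outside `H` could be deleted, against minimality.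
  have hbridge : ∀ e ∈ G₀.edgeSet, e ∉ H → G₀.IsBridge e := by
    intro e he heH
    by_contra hb
    induction e using Sym2.ind with
    | _ a b =>
      have h1 := hconn.connected_delete_edge_of_not_isBridge hb
      have h2 : G₀.deleteEdges {s(a, b)} ∈ {G' : SimpleGraph V | G' ≤ G ∧ H ⊆ G'.edgeSet ∧
          G'.Connected} := by
        refine ⟨(SimpleGraph.deleteEdges_le _).trans hle, fun f hf => ?_, h1⟩
        rw [SimpleGraph.edgeSet_deleteEdges]
        exact ⟨hH₀ hf, fun hfe => heH (Set.mem_singleton_iff.1 hfe ▸ hf)⟩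
      have h3 : G₀ ≤ G₀.deleteEdges {s(a, b)} := hmin.le_of_le h2 (SimpleGraph.deleteEdges_le _)
      have h4 := h3 (show G₀.Adj a b from he)
      rw [SimpleGraph.deleteEdges_adj] at h4
      exact h4.2 rfl
  -- Cycles contain no bridges, so every cycle of `G₀` has its edges in `H` and is one of the three.
  have hall : ∀ u (q : G₀.Walk u u), q.IsCycle → ∃ i, ∀ e, e ∈ q.edges ↔ e ∈ (C i).edgeSet := by
    intro u q hq
    have hqe : ∀ e, e ∈ (q.mapLe hle).toSubgraph.edgeSet ↔ e ∈ q.edges := fun e => by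
      rw [SimpleGraph.Walk.mem_edges_toSubgraph, SimpleGraph.Walk.edges_mapLe_eq_edges]
    obtain ⟨i, hi⟩ := heq (q.mapLe hle).toSubgraph ⟨u, _, hq.mapLe hle, rfl⟩ fun e he => by
      rw [hqe] at he
      by_contra hn
      exact (hbridge e (q.edges_subset_edgeSet he) hn).notMem_edges_of_isCycle hq he
    exact ⟨i, fun e => by rw [← hi, hqe]⟩
  have hgate : ∀ i, ∃ (ℓ : ℕ) (r : ℕ → V) (γ : V → V), GatedCycle G₀ ℓ r γ ∧
      ∀ j, s(r j, r (j + 1)) ∈ (C i).edgeSet := by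
    intro i
    obtain ⟨v, p, hp, hpC⟩ := hcyc i
    have hpe : ∀ e, e ∈ p.edges ↔ e ∈ (C i).edgeSet := fun e => by
      rw [← hpC, SimpleGraph.Walk.mem_edges_toSubgraph]
    have hp₀ : ∀ e ∈ p.edges, e ∈ G₀.edgeSet := fun e he => hH₀ (hCH i ((hpe e).1 he))
    have hedges : (p.transfer G₀ hp₀).edges = p.edges := p.edges_transfer hp₀
    obtain ⟨γ, hγ⟩ := exists_gatedCycle hconn (hp.transfer hp₀) (by
      intro u q hq e heq' hep e' hep'
      rw [hedges, hpe] at hep hep'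
      obtain ⟨k, hk⟩ := hall u q hq
      rw [hk] at heq' ⊢
      by_cases hik : i = k
      · rwa [← hik]
      · exact absurd heq' (Set.disjoint_left.1 (hdisj i k hik) hep))
    refine ⟨_, _, γ, hγ, fun j => ?_⟩
    rcases hall _ _ (hp.transfer hp₀) with ⟨k, hk⟩
    rw [← hpe, ← hedges]
    have hlt := Nat.mod_lt j (show 0 < (p.transfer G₀ hp₀).length by
      have := hγ.three_le; omega)
    rw [SimpleGraph.Walk.mk_mem_edges_iff_exists]
    refine ⟨j % (p.transfer G₀ hp₀).length, hlt, ?_⟩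
    congr 1
    have h3 := hγ.three_le
    rw [Nat.add_mod j 1, Nat.mod_eq_of_lt (show 1 < (p.transfer G₀ hp₀).length by omega)]
    rcases Nat.lt_or_ge (j % (p.transfer G₀ hp₀).length + 1) (p.transfer G₀ hp₀).length with h | h
    · rw [Nat.mod_eq_of_lt h]
    · have h' : j % (p.transfer G₀ hp₀).length + 1 = (p.transfer G₀ hp₀).length := by omega
      rw [h', Nat.mod_self, SimpleGraph.Walk.getVert_zero, SimpleGraph.Walk.getVert_length]
  choose ℓ r γ hγ hE using hgate
  refine ⟨G₀, hle, hconn, ℓ, r, γ, hγ, fun i j hij => ?_⟩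
  -- An edge of the `j`-th cycle is not an edge of the `i`-th, so its ends have the same gate there.
  have h1 : ∀ a, γ i (r j a) = γ i (r j (a + 1)) := fun a => by
    refine ((hγ i).edge _ _ ((hγ j).adj a)).resolve_right ?_
    rintro ⟨k, hk⟩
    exact Set.disjoint_left.1 (hdisj i j hij) (hk ▸ hE i k) (hE j a)
  have h2 : ∀ a, γ i (r j a) = γ i (r j 0) := fun a => by
    induction a with
    | zero => rfl
    | succ a ih => rw [← h1, ih]
  intro a b
  rw [h2 a, h2 b]

end Structure

end DistSpec

/-! ### Placing the light part on the clique end of the kite. -/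

namespace DistSpec

section KiteOrder

/-- Numbering compatible with `ρ`, obtained by putting a vertex of largest `ρ` last. It makes
parents come before children. -/
theorem exists_rank_order {V : Type*} [DecidableEq V] (ρ : V → ℕ) (n : ℕ) :
    ∀ Z : Finset V, Z.card = n → ∃ s : V → ℕ, (∀ z ∈ Z, 1 ≤ s z ∧ s z ≤ n) ∧ Set.InjOn s Z ∧
      ∀ u ∈ Z, ∀ v ∈ Z, ρ u < ρ v → s u < s v := by
  induction n with
  | zero =>
    intro Z hZ
    rw [Finset.card_eq_zero] at hZ
    subst hZ
    exact ⟨fun _ => 0, by simp, by simp, by simp⟩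
  | succ n ih =>
    intro Z hZ
    obtain ⟨v, hv, hmax⟩ := Z.exists_max_image ρ (Finset.card_pos.1 (by omega))
    obtain ⟨s, h1, h2, h3⟩ := ih (Z.erase v) (by rw [Finset.card_erase_of_mem hv]; omega)
    have hm : ∀ z ∈ Z, z ≠ v → z ∈ Z.erase v := fun z hz hzv => Finset.mem_erase.2 ⟨hzv, hz⟩
    refine ⟨fun z => if z = v then n + 1 else s z, fun z hz => ?_, fun a ha b hb hab => ?_,
      fun a ha b hb hab => ?_⟩
    · by_cases hzv : z = v
      · simp [hzv]
      · have := h1 z (hm z hz hzv)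
        simp only [hzv, if_false]
        omega
    · by_cases hav : a = v <;> by_cases hbv : b = v
      · rw [hav, hbv]
      · have := h1 b (hm b hb hbv)
        simp only [hav, hbv, if_true, if_false] at hab
        omega
      · have := h1 a (hm a ha hav)
        simp only [hav, hbv, if_true, if_false] at hab
        omega
      · simp only [hav, hbv, if_false] at hab
        exact h2 (hm a ha hav) (hm b hb hbv) hab
    · by_cases hav : a = v
      · have := hmax b hb
        rw [hav] at hab
        omega
      · by_cases hbv : b = v
        · have := h1 a (hm a ha hav)
          simp only [hav, hbv, if_true, if_false]
          omega
        · simp only [hav, hbv, if_false]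
          exact h3 a (hm a ha hav) b (hm b hb hbv) hab

variable {V : Type*} [Fintype V] [DecidableEq V] {G : SimpleGraph V} {ℓ : ℕ} {r : ℕ → V}
  {γ : V → V}

/-- Climbing from `a` through parents meets every distance from `G.dist (γ a) a` down to `0` inside
the pile. -/
theorem GatedCycle.dist_lt_card_pile (h : GatedCycle G ℓ r γ) (hG : G.Connected) (a : V) :
    G.dist (γ a) a < (Finset.univ.filter fun u => γ u = γ a).card := by
  have hk : ∀ n u, γ u = γ a → G.dist (γ a) u = n →
      ∀ k ≤ n, ∃ v, γ v = γ a ∧ G.dist (γ a) v = k := by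
    intro n
    induction n with
    | zero => exact fun u hu h0 k hk => ⟨u, hu, by omega⟩
    | succ n ih =>
      intro u hu hn k hk
      rcases Nat.lt_or_ge k (n + 1) with hlt | hge
      · have hγ : γ u ≠ u := by
          intro e
          rw [← hu, e, SimpleGraph.dist_self] at hn
          omega
        obtain ⟨z, hz, hγz, hlt'⟩ := h.exists_parent hG hγ
        have h1 := hG.dist_triangle (u := γ a) (v := z) (w := u)
        rw [SimpleGraph.dist_eq_one_iff_adj.2 hz.symm] at h1
        rw [hu] at hlt' hγz
        exact ih z hγz (by omega) k (by omega)
      · exact ⟨u, hu, by omega⟩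
  have hsub : Finset.range (G.dist (γ a) a + 1) ⊆
      (Finset.univ.filter fun u => γ u = γ a).image fun u => G.dist (γ a) u := by
    intro k hk'
    obtain ⟨v, hv, hvk⟩ := hk _ a rfl rfl k (by have := Finset.mem_range.1 hk'; omega)
    exact Finset.mem_image.2 ⟨v, Finset.mem_filter.2 ⟨Finset.mem_univ _, hv⟩, hvk⟩
  have := (Finset.card_le_card hsub).trans Finset.card_image_le
  rw [Finset.card_range] at this
  omega

/-- The vertices that do not hang at `r 0` can be put onto the clique end of a kite in such a way
that distances to `r 0` exceed those in the kite by at most one, with enough room for the mutual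
distances. -/
theorem GatedCycle.exists_kite_order (h : GatedCycle G ℓ r γ) (hG : G.Connected) {X : Finset V}
    (hX : ∀ u, u ∈ X ↔ γ u ≠ r 0) {m : ℕ} (hm : X.card = m) :
    2 ≤ m ∧ ∃ c : V → ℕ, (∀ u ∈ X, c u < m) ∧ Set.InjOn c X ∧
      (∀ u ∈ X, G.dist (r 0) u + max (c u) 2 ≤ m + 1) ∧
      (∀ u ∈ X, ∀ v ∈ X, u ≠ v →
        G.dist u v + G.dist (r 0) u + G.dist (r 0) v + max (c u) 2 + max (c v) 2 ≤
          2 * m + 2 + max 1 ((max (c u) 2 : ℕ) - (max (c v) 2 : ℕ) : ℤ).natAbs) ∧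
      (m = 2 ∨ ∃ u ∈ X, G.dist (r 0) u + max (c u) 2 ≤ m) := by
  obtain ⟨idx, hidx⟩ := h.exists_index
  have hℓ := h.three_le
  have hne : ∀ i j, i < ℓ → j < ℓ → i ≠ j → r i ≠ r j := fun i j hi hj hij e => by
    rw [h.eq_iff, Nat.mod_eq_of_lt hi, Nat.mod_eq_of_lt hj] at e
    exact hij e
  have hrℓ : r ℓ = r 0 := by
    have := h.add_period 0 1
    simpa using this
  have hidx_r : ∀ j < ℓ, idx (r j) = j := fun j hj => by
    have := (hidx (r j)).2
    rw [h.gate_self, h.eq_iff, Nat.mod_eq_of_lt (hidx _).1, Nat.mod_eq_of_lt hj] at this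
    exact this
  have hidx_gate : ∀ u v, γ u = γ v → idx u = idx v := fun u v e => by
    rw [← (hidx u).2, ← (hidx v).2, h.eq_iff, Nat.mod_eq_of_lt (hidx u).1,
      Nat.mod_eq_of_lt (hidx v).1] at e
    exact e
  set w := r 0 with hw
  have hwX : w ∉ X := fun e => (hX w).1 e (h.gate_self 0)
  -- Deepest vertices of the piles at `r 1` and `r 2` will take the clique positions `1` and `0`.
  -- Being deepest, they need not serve as parents of other vertices.
  have hdeep : ∀ j, ∃ a, γ a = r j ∧ ∀ u, γ u = r j → G.dist (r j) u ≤ G.dist (r j) a := by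
    intro j
    obtain ⟨a, ha, hmax⟩ := (Finset.univ.filter fun u => γ u = r j).exists_max_image
      (fun u => G.dist (r j) u) ⟨r j, by simp [h.gate_self]⟩
    exact ⟨a, (Finset.mem_filter.1 ha).2, fun u hu => hmax u (by simp [hu])⟩
  obtain ⟨a, haγ, hamax⟩ := hdeep 1
  obtain ⟨b, hbγ, hbmax⟩ := hdeep 2
  have h10 : r 1 ≠ w := hne 1 0 (by omega) (by omega) (by omega)
  have h20 : r 2 ≠ w := hne 2 0 (by omega) (by omega) (by omega)
  have h12 : r 1 ≠ r 2 := hne 1 2 (by omega) (by omega) (by omega)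
  have haX : a ∈ X := (hX a).2 (by rw [haγ]; exact h10)
  have hbX : b ∈ X := (hX b).2 (by rw [hbγ]; exact h20)
  have hab : a ≠ b := by
    rintro rfl
    exact h12 (haγ.symm.trans hbγ)
  -- `ρ` decreases towards `w` along a spanning structure: down each pile to its gate, then forward
  -- round the cycle to `r ℓ = r 0`. The vertex `r 1` uses the direct edge to `w` instead.
  set ρ : V → ℕ := fun u => (ℓ - idx u) + G.dist (γ u) u with hρ
  -- every vertex of `X` has a parent closer to `w`, different from `a` and `b`
  have hpar : ∀ u ∈ X, ∃ z, G.Adj u z ∧ z ≠ a ∧ z ≠ b ∧ (z = w ∨ (z ∈ X ∧ ρ z < ρ u)) := by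
    intro u hu
    have huw := (hX u).1 hu
    by_cases hγ : γ u = u
    · have hui : r (idx u) = u := (hidx u).2.trans hγ
      have hul := (hidx u).1
      have hi0 : idx u ≠ 0 := by
        intro e
        rw [e] at hui
        exact huw (by rw [hγ, ← hui])
      by_cases hi1 : idx u = 1
      · rw [hi1] at hui
        refine ⟨w, ?_, fun e => hwX (e ▸ haX), fun e => hwX (e ▸ hbX), Or.inl rfl⟩
        rw [← hui]
        exact (h.adj 0).symm
      · have hadj := h.adj (idx u)
        rw [hui] at hadj
        rcases Nat.lt_or_ge (idx u + 1) ℓ with hlt | hge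
        · refine ⟨r (idx u + 1), hadj, fun e => ?_, fun e => ?_, Or.inr ⟨(hX _).2 ?_, ?_⟩⟩
          · have := haγ
            rw [← e, h.gate_self] at this
            exact hne _ 1 hlt (by omega) (by omega) this
          · have := hbγ
            rw [← e, h.gate_self] at this
            exact hne _ 2 hlt (by omega) (by omega) this
          · rw [h.gate_self]
            exact hne _ 0 hlt (by omega) (by omega)
          · simp only [hρ, hidx_r _ hlt, h.gate_self, hγ, SimpleGraph.dist_self]
            omega
        · have : idx u + 1 = ℓ := by omega
          rw [this, hrℓ] at hadj
          exact ⟨w, hadj, fun e => hwX (e ▸ haX), fun e => hwX (e ▸ hbX), Or.inl rfl⟩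
    · obtain ⟨z, hz, hγz, hlt⟩ := h.exists_parent hG hγ
      refine ⟨z, hz, ?_, ?_, Or.inr ⟨(hX z).2 (by rw [hγz]; exact huw), ?_⟩⟩
      · rintro rfl
        have := hamax u (hγz.symm.trans haγ)
        rw [← hγz, haγ] at hlt
        omega
      · rintro rfl
        have := hbmax u (hγz.symm.trans hbγ)
        rw [← hγz, hbγ] at hlt
        omega
      · simp only [hρ, hidx_gate z u hγz, hγz]
        omega
  set Z := (X.erase a).erase b with hZ
  have hZmem : ∀ u, u ∈ Z ↔ u ∈ X ∧ u ≠ a ∧ u ≠ b := fun u => by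
    simp only [hZ, Finset.mem_erase]
    tauto
  have hbXa : b ∈ X.erase a := Finset.mem_erase.2 ⟨hab.symm, hbX⟩
  have hZcard : Z.card + 2 = m := by
    have h1 : Z.card + 1 = (X.erase a).card := Finset.card_erase_add_one hbXa
    have h2 := Finset.card_erase_add_one haX
    omega
  obtain ⟨s, hs1, hs2, hs3⟩ := exists_rank_order ρ Z.card Z rfl
  have hs2' : ∀ u ∈ Z, ∀ v ∈ Z, s u = s v → u = v := fun u hu v hv e => hs2 hu hv e
  have hparZ : ∀ u ∈ X, ∃ z, G.Adj u z ∧ (z = w ∨ (z ∈ Z ∧ (u ∈ Z → s z < s u))) := by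
    intro u hu
    obtain ⟨z, hz, hza, hzb, hzw⟩ := hpar u hu
    refine ⟨z, hz, hzw.imp id fun ⟨hzX, hlt⟩ => ?_⟩
    have hzZ : z ∈ Z := (hZmem z).2 ⟨hzX, hza, hzb⟩
    exact ⟨hzZ, fun huZ => hs3 z hzZ u huZ hlt⟩
  -- The perimeter of the triangle `w, u, v`. Replacing a corner by its parent changes it by at most
  -- two, so corners of rank at most `n` give perimeter at most `2 * n`.
  set per : V → V → ℕ := fun u v => G.dist u v + G.dist w u + G.dist w v with hper
  have hper_symm : ∀ u v, per u v = per v u := fun u v => by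
    simp only [hper, G.dist_comm (u := u) (v := v)]
    omega
  have hper_adj : ∀ u z v, G.Adj u z → per u v ≤ per z v + 2 := fun u z v huz => by
    have e := SimpleGraph.dist_eq_one_iff_adj.2 huz
    have h1 := hG.dist_triangle (u := u) (v := z) (w := v)
    have h2 := hG.dist_triangle (u := w) (v := z) (w := u)
    rw [G.dist_comm (u := z) (v := u)] at h2
    simp only [hper]
    omega
  have hper_self : ∀ u z, G.Adj u z → per u u ≤ per z z + 2 := fun u z huz => by
    have e := SimpleGraph.dist_eq_one_iff_adj.2 huz
    have h2 := hG.dist_triangle (u := w) (v := z) (w := u)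
    rw [G.dist_comm (u := z) (v := u)] at h2
    simp only [hper, SimpleGraph.dist_self]
    omega
  have hperZ : ∀ n, ∀ u v, (u = w ∨ (u ∈ Z ∧ s u ≤ n)) → (v = w ∨ (v ∈ Z ∧ s v ≤ n)) →
      per u v ≤ 2 * n := by
    intro n
    induction n with
    | zero =>
      intro u v hu hv
      have hu' : u = w := hu.resolve_right fun e => by have := hs1 u e.1; omega
      have hv' : v = w := hv.resolve_right fun e => by have := hs1 v e.1; omega
      simp [hper, hu', hv']
    | succ n ih =>
      have step : ∀ u v, u ∈ Z → s u = n + 1 → (v = w ∨ (v ∈ Z ∧ s v ≤ n)) →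
          per u v ≤ 2 * (n + 1) := by
        intro u v hu hsu hv
        obtain ⟨z, hz, hzw⟩ := hparZ u ((hZmem u).1 hu).1
        have h1 := hper_adj u z v hz
        have h2 := ih z v (hzw.imp id fun e => ⟨e.1, by have := e.2 hu; omega⟩) hv
        omega
      intro u v hu hv
      have hcase : ∀ u, (u = w ∨ (u ∈ Z ∧ s u ≤ n + 1)) →
          (u = w ∨ (u ∈ Z ∧ s u ≤ n)) ∨ (u ∈ Z ∧ s u = n + 1) := by
        rintro u (e | ⟨e1, e2⟩)
        · exact Or.inl (Or.inl e)
        · rcases Nat.lt_or_ge (s u) (n + 1) with h1 | h1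
          · exact Or.inl (Or.inr ⟨e1, by omega⟩)
          · exact Or.inr ⟨e1, by omega⟩
      rcases hcase u hu with hu | ⟨hu, hsu⟩ <;> rcases hcase v hv with hv | ⟨hv, hsv⟩
      · have := ih u v hu hv
        omega
      · rw [hper_symm]
        exact step v u hv hsv hu
      · exact step u v hu hsu hv
      · have huv := hs2' u hu v hv (by omega)
        subst huv
        obtain ⟨z, hz, hzw⟩ := hparZ u ((hZmem u).1 hu).1
        have hz' : z = w ∨ (z ∈ Z ∧ s z ≤ n) :=
          hzw.imp id fun e => ⟨e.1, by have := e.2 hu; omega⟩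
        have h1 := hper_self u z hz
        have h2 := ih z z hz' hz'
        omega
  have hperl : ∀ u ∈ X, ∀ v ∈ Z, per u v ≤ 2 * (m - 1) := by
    intro u hu v hv
    obtain ⟨z, hz, hzw⟩ := hparZ u hu
    have h1 := hper_adj u z v hz
    have h2 := hperZ Z.card z v (hzw.imp id fun e => ⟨e.1, (hs1 z e.1).2⟩)
      (Or.inr ⟨hv, (hs1 v hv).2⟩)
    omega
  have hdl : ∀ u ∈ X, G.dist w u ≤ m - 1 := by
    intro u hu
    obtain ⟨z, hz, hzw⟩ := hparZ u hu
    have h1 := hper_self u z hz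
    have hz' : z = w ∨ (z ∈ Z ∧ s z ≤ Z.card) := hzw.imp id fun e => ⟨e.1, (hs1 z e.1).2⟩
    have h2 := hperZ Z.card z z hz' hz'
    simp only [hper, SimpleGraph.dist_self] at h1 h2
    omega
  have hdZ : ∀ u ∈ Z, G.dist w u ≤ s u := by
    intro u hu
    have h2 := hperZ (s u) u u (Or.inr ⟨hu, le_rfl⟩) (Or.inr ⟨hu, le_rfl⟩)
    simp only [hper, SimpleGraph.dist_self] at h2
    omega
  -- Both `a` and `b` have `max (c ·) 2 = 2` and are at kite distance one, so the parent bound `2 *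
  -- m` is one too large. For `ℓ = 3` the cycle contributes only three to the perimeter. For `ℓ ≥ 4`
  -- the vertex `r 3` lies in `X` outside both piles and saves one in the count.
  have hperab : per a b ≤ 2 * m - 1 := by
    set A := Finset.univ.filter fun u => γ u = r 1 with hA
    set B := Finset.univ.filter fun u => γ u = r 2 with hB
    have hAc : G.dist (r 1) a < A.card := by
      have := h.dist_lt_card_pile hG a
      rwa [haγ] at this
    have hBc : G.dist (r 2) b < B.card := by
      have := h.dist_lt_card_pile hG b
      rwa [hbγ] at this
    have hAB : Disjoint A B := by
      rw [Finset.disjoint_left]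
      intro u hu hu'
      have e1 := (Finset.mem_filter.1 hu).2
      have e2 := (Finset.mem_filter.1 hu').2
      exact h12 (e1.symm.trans e2)
    have hABX : A ∪ B ⊆ X := by
      intro u hu
      rcases Finset.mem_union.1 hu with hu | hu
      · rw [hX, (Finset.mem_filter.1 hu).2]
        exact h10
      · rw [hX, (Finset.mem_filter.1 hu).2]
        exact h20
    have hcardAB : A.card + B.card ≤ m := by
      rw [← Finset.card_union_of_disjoint hAB, ← hm]
      exact Finset.card_le_card hABX
    have t1 := hG.dist_triangle (u := a) (v := r 1) (w := b)
    have t2 := hG.dist_triangle (u := r 1) (v := r 2) (w := b)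
    have t3 := hG.dist_triangle (u := w) (v := r 1) (w := a)
    have t4 := hG.dist_triangle (u := w) (v := r 2) (w := b)
    have e1 : G.dist (r 1) (r 2) = 1 := SimpleGraph.dist_eq_one_iff_adj.2 (h.adj 1)
    have e2 : G.dist w (r 1) = 1 := SimpleGraph.dist_eq_one_iff_adj.2 (h.adj 0)
    have e3 := G.dist_comm (u := a) (v := r 1)
    simp only [hper]
    rcases Nat.lt_or_ge ℓ 4 with h4 | h4
    · have h3 : ℓ = 3 := by omega
      have hadj := h.adj 2
      rw [h3] at hrℓ
      rw [hrℓ] at hadj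
      have e4 : G.dist w (r 2) = 1 := SimpleGraph.dist_eq_one_iff_adj.2 hadj.symm
      omega
    · have h30 : r 3 ∈ X := (hX _).2 (by
        rw [h.gate_self]
        exact hne 3 0 (by omega) (by omega) (by omega))
      have h3AB : r 3 ∉ A ∪ B := by
        intro hu
        rcases Finset.mem_union.1 hu with hu | hu
        · have := (Finset.mem_filter.1 hu).2
          rw [h.gate_self] at this
          exact hne 3 1 (by omega) (by omega) (by omega) this
        · have := (Finset.mem_filter.1 hu).2
          rw [h.gate_self] at this
          exact hne 3 2 (by omega) (by omega) (by omega) this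
      have hlt : (A ∪ B).card < X.card := Finset.card_lt_card
        ⟨hABX, fun e => h3AB (e h30)⟩
      rw [Finset.card_union_of_disjoint hAB, hm] at hlt
      have e4 := hG.dist_triangle (u := w) (v := r 1) (w := r 2)
      omega
  -- Low rank, that is, close to `w`, means a position close to the tail. Ranks are at most `m - 2`,
  -- so `m - s u ≥ 2` leaves `0` and `1` to `b` and `a`.
  refine ⟨by omega, fun u => if u = b then 0 else if u = a then 1 else m - s u, ?_, ?_, ?_, ?_, ?_⟩
  · intro u hu
    by_cases hub : u = b
    · simp only [hub, if_true]; omega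
    by_cases hua : u = a
    · simp only [hua, if_false, if_true, hab]; omega
    have := hs1 u ((hZmem u).2 ⟨hu, hua, hub⟩)
    simp only [hub, hua, if_false]
    omega
  · intro u hu v hv huv
    by_cases hub : u = b <;> by_cases hvb : v = b
    · rw [hub, hvb]
    · by_cases hva : v = a
      · simp [hub, hva, hab] at huv
      · have := hs1 v ((hZmem v).2 ⟨hv, hva, hvb⟩)
        simp only [hub, hvb, hva, if_true, if_false] at huv
        omega
    · by_cases hua : u = a
      · simp [hvb, hua, hab] at huv
      · have := hs1 u ((hZmem u).2 ⟨hu, hua, hub⟩)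
        simp only [hub, hvb, hua, if_true, if_false] at huv
        omega
    · by_cases hua : u = a <;> by_cases hva : v = a
      · rw [hua, hva]
      · have := hs1 v ((hZmem v).2 ⟨hv, hva, hvb⟩)
        simp [hvb, hua, hva, hab] at huv
        omega
      · have := hs1 u ((hZmem u).2 ⟨hu, hua, hub⟩)
        simp [hub, hua, hva, hab] at huv
        omega
      · have h1 := hs1 v ((hZmem v).2 ⟨hv, hva, hvb⟩)
        have h2 := hs1 u ((hZmem u).2 ⟨hu, hua, hub⟩)
        simp only [hub, hvb, hua, hva, if_false] at huv
        exact hs2' u ((hZmem u).2 ⟨hu, hua, hub⟩) v ((hZmem v).2 ⟨hv, hva, hvb⟩) (by omega)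
  · intro u hu
    have h1 := hdl u hu
    beta_reduce
    by_cases hub : u = b
    · rw [if_pos hub]; omega
    by_cases hua : u = a
    · rw [if_neg hub, if_pos hua]; omega
    have huZ := (hZmem u).2 ⟨hu, hua, hub⟩
    have h2 := hs1 u huZ
    have h3 := hdZ u huZ
    rw [if_neg hub, if_neg hua]
    omega
  · have key : ∀ u ∈ X, ∀ v ∈ Z, u ≠ v → (u = a ∨ u = b ∨ (u ∈ Z ∧ s u < s v)) →
        G.dist u v + G.dist w u + G.dist w v +
          max (if u = b then 0 else if u = a then 1 else m - s u) 2 +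
          max (if v = b then 0 else if v = a then 1 else m - s v) 2 ≤
        2 * m + 2 + max 1 ((max (if u = b then 0 else if u = a then 1 else m - s u) 2 : ℕ) -
          (max (if v = b then 0 else if v = a then 1 else m - s v) 2 : ℕ) : ℤ).natAbs := by
      intro u hu v hv huv hc
      have hv' := (hZmem v).1 hv
      rw [if_neg hv'.2.2, if_neg hv'.2.1]
      have h1 := hperl u hu v hv
      have h2 := hs1 v hv
      simp only [hper] at h1
      by_cases hub : u = b
      · rw [if_pos hub]; omega
      by_cases hua : u = a
      · rw [if_neg hub, if_pos hua]; omega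
      rw [if_neg hub, if_neg hua]
      obtain ⟨huZ, hlt⟩ := (hc.resolve_left hua).resolve_left hub
      have h3 := hs1 u huZ
      have h4 := hperZ (s v) u v (Or.inr ⟨huZ, hlt.le⟩) (Or.inr ⟨hv, le_rfl⟩)
      simp only [hper] at h4
      omega
    have key' : ∀ u ∈ X, ∀ v ∈ Z, u ≠ v → (u = a ∨ u = b ∨ (u ∈ Z ∧ s u < s v)) →
        G.dist v u + G.dist w v + G.dist w u +
          max (if v = b then 0 else if v = a then 1 else m - s v) 2 +
          max (if u = b then 0 else if u = a then 1 else m - s u) 2 ≤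
        2 * m + 2 + max 1 ((max (if v = b then 0 else if v = a then 1 else m - s v) 2 : ℕ) -
          (max (if u = b then 0 else if u = a then 1 else m - s u) 2 : ℕ) : ℤ).natAbs := by
      intro u hu v hv huv hc
      have := key u hu v hv huv hc
      rw [G.dist_comm]
      omega
    intro u hu v hv huv
    simp only [hper] at hperab
    by_cases huZ : u ∈ Z <;> by_cases hvZ : v ∈ Z
    · rcases Nat.lt_trichotomy (s u) (s v) with hlt | heq | hlt
      · exact key u hu v hvZ huv (Or.inr (Or.inr ⟨huZ, hlt⟩))
      · exact absurd (hs2' u huZ v hvZ heq) huv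
      · exact key' v hv u huZ huv.symm (Or.inr (Or.inr ⟨hvZ, hlt⟩))
    · refine key' v hv u huZ huv.symm ?_
      by_contra! hcon
      exact hvZ ((hZmem v).2 ⟨hv, hcon.1, hcon.2.1⟩)
    · refine key u hu v hvZ huv ?_
      by_contra! hcon
      exact huZ ((hZmem u).2 ⟨hu, hcon.1, hcon.2.1⟩)
    · have hu' : u = a ∨ u = b := by
        by_contra! hcon
        exact huZ ((hZmem u).2 ⟨hu, hcon.1, hcon.2⟩)
      have hv' : v = a ∨ v = b := by
        by_contra! hcon
        exact hvZ ((hZmem v).2 ⟨hv, hcon.1, hcon.2⟩)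
      rcases hu' with rfl | rfl <;> rcases hv' with rfl | rfl
      · exact absurd rfl huv
      · simp only [hab, if_true, if_false]
        omega
      · have := G.dist_comm (u := u) (v := v)
        simp only [hab, if_true, if_false]
        omega
      · exact absurd rfl huv
  -- For `m > 2` any `z ∈ Z` has spare room, since `G.dist w z ≤ s z = m - c z`.
  · by_cases hm2 : m = 2
    · exact Or.inl hm2
    right
    obtain ⟨z, hz⟩ : Z.Nonempty := Finset.card_pos.1 (by omega)
    have h1 := hs1 z hz
    have h2 := hdZ z hz
    have hz' := (hZmem z).1 hz
    refine ⟨z, hz'.1, ?_⟩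
    beta_reduce
    rw [if_neg hz'.2.2, if_neg hz'.2.1]
    omega

end KiteOrder

end DistSpec

/-! ### Choosing the light cycle and ordering the opposite pile. -/

namespace DistSpec

section Selection

variable {V : Type*}

theorem GatedCycle.induce {G : SimpleGraph V} {ℓ : ℕ} {r : ℕ → V} {γ : V → V}
    (h : GatedCycle G ℓ r γ) {S : V → Prop} (hr : ∀ j, S (r j)) (hγ : ∀ u, S (γ u)) :
    GatedCycle (G.comap (Subtype.val : {u // S u} → V)) ℓ (fun j => ⟨r j, hr j⟩)
      (fun u => ⟨γ u, hγ u⟩) := by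
  refine ⟨h.three_le, fun i j => ?_, fun j => h.adj j, fun u => ?_, fun j => ?_, fun u v huv => ?_⟩
  · rw [Subtype.mk.injEq, h.eq_iff]
  · obtain ⟨j, hj⟩ := h.gate_mem u
    exact ⟨j, Subtype.ext hj⟩
  · exact Subtype.ext (h.gate_self j)
  · rcases h.edge u v huv with e | ⟨j, hj⟩
    · exact Or.inl (Subtype.ext e)
    · refine Or.inr ⟨j, ?_⟩
      rcases Sym2.eq_iff.1 hj with ⟨e1, e2⟩ | ⟨e1, e2⟩
      · exact Sym2.eq_iff.2 (Or.inl ⟨Subtype.ext e1, Subtype.ext e2⟩)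
      · exact Sym2.eq_iff.2 (Or.inr ⟨Subtype.ext e1, Subtype.ext e2⟩)

theorem GatedCycle.pile_connected {G : SimpleGraph V} {ℓ : ℕ} {r : ℕ → V} {γ : V → V}
    (h : GatedCycle G ℓ r γ) (hG : G.Connected) {w : V} (hw : γ w = w) :
    (G.comap (Subtype.val : {u // γ u = w} → V)).Connected := by
  have key : ∀ n, ∀ u : {u // γ u = w}, G.dist w u = n →
      (G.comap (Subtype.val : {u // γ u = w} → V)).Reachable u ⟨w, hw⟩ := by
    intro n
    induction n using Nat.strong_induction_on with
    | _ n ih =>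
      intro u hu
      by_cases hγ : γ u = u
      · have : u = ⟨w, hw⟩ := Subtype.ext (hγ.symm.trans u.2)
        rw [this]
      · obtain ⟨z, hz, hγz, hlt⟩ := h.exists_parent hG hγ
        rw [u.2] at hlt hγz
        have h1 := ih _ (hu ▸ hlt) ⟨z, hγz⟩ rfl
        exact (SimpleGraph.Adj.reachable (show
          (G.comap (Subtype.val : {u // γ u = w} → V)).Adj u ⟨z, hγz⟩ from hz)).trans h1
  have : Nonempty {u // γ u = w} := ⟨⟨w, hw⟩⟩
  exact ⟨fun u v => (key _ u rfl).trans (key _ v rfl).symm⟩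

/-- What does not hang at the same vertex of a second cycle as the first cycle hangs at the same
vertex of the first cycle as the second cycle. -/
theorem GatedCycle.gate_eq_of_gate_ne {G : SimpleGraph V} (hG : G.Connected) {ℓ ℓ' : ℕ}
    {r r' : ℕ → V} {γ γ' : V → V} (h : GatedCycle G ℓ r γ) (h' : GatedCycle G ℓ' r' γ')
    (hr : ∀ i j, γ' (r i) = γ' (r j)) (hr' : ∀ i j, γ (r' i) = γ (r' j)) {u : V}
    (hu : γ' u ≠ γ' (r 0)) : γ u = γ (r' 0) := by
  have key : ∀ n u, G.dist (γ' u) u = n → γ' u ≠ γ' (r 0) → γ u = γ (r' 0) := by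
    intro n
    induction n using Nat.strong_induction_on with
    | _ n ih =>
      intro u hn hu
      by_cases hγ : γ' u = u
      · obtain ⟨j, hj⟩ := h'.gate_mem u
        rw [hγ] at hj
        rw [hj]
        exact hr' j 0
      · obtain ⟨z, hz, hγz, hlt⟩ := h'.exists_parent hG hγ
        have h1 := ih _ (hn ▸ hlt) z (by rw [hγz]) (by rw [hγz]; exact hu)
        rcases h.edge_gate hz with e | ⟨e, -⟩
        · rw [e, h1]
        · obtain ⟨j, hj⟩ := h.gate_mem u
          rw [e] at hj
          exact absurd (by rw [hj]; exact hr j 0) hu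
  exact key _ u rfl hu

variable [Fintype V] [DecidableEq V]

/-- Among three gated cycles there is one such that the others hang at the same vertex of it and
such that what hangs at its other vertices is light. -/
theorem exists_light_cycle {G : SimpleGraph V} (hG : G.Connected) {ℓ : Fin 3 → ℕ}
    {r : Fin 3 → ℕ → V} {γ : Fin 3 → V → V} (h : ∀ i, GatedCycle G (ℓ i) (r i) (γ i))
    (hr : ∀ i j, i ≠ j → ∀ a b, γ i (r j a) = γ i (r j b)) {x : V → ℝ} (hx : ∀ v, 0 < x v) :
    ∃ i j k, i ≠ j ∧ i ≠ k ∧ j ≠ k ∧ γ i (r j 0) = γ i (r k 0) ∧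
      ∑ u with γ i u ≠ γ i (r j 0), x u ≤ ∑ u with γ j u ≠ γ j (r i 0), x u ∧
      ∑ u with γ i u ≠ γ i (r j 0), x u ≤ ∑ u with γ k u ≠ γ k (r i 0), x u := by
  obtain ⟨⟨i, j⟩, hij, hmin⟩ := (Finset.univ.filter fun p : Fin 3 × Fin 3 => p.1 ≠ p.2).exists_min_image
    (fun p => ∑ u with γ p.1 u ≠ γ p.1 (r p.2 0), x u) ⟨(0, 1), by simp⟩
  have hij : i ≠ j := (Finset.mem_filter.1 hij).2
  have hmin' : ∀ a b, a ≠ b → ∑ u with γ i u ≠ γ i (r j 0), x u ≤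
      ∑ u with γ a u ≠ γ a (r b 0), x u := fun a b hab => hmin (a, b) (by simp [hab])
  have hthird : ∀ i j : Fin 3, ∃ k, i ≠ k ∧ j ≠ k := by decide
  obtain ⟨k, hik, hjk⟩ := hthird i j
  refine ⟨i, j, k, hij, hik, hjk, ?_, hmin' j i hij.symm, hmin' k i hik.symm⟩
  by_contra hne
  -- If the `k`-th cycle hung at another vertex of the `i`-th, everything on its far side would hang
  -- there as well, giving a smaller set than the minimal one. It is strictly smaller, as the `i`-th
  -- cycle has a third vertex carrying neither of the other cycles.
  have hlt : ∑ u with γ k u ≠ γ k (r i 0), x u < ∑ u with γ i u ≠ γ i (r j 0), x u := by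
    have hsub : (Finset.univ.filter fun u => γ k u ≠ γ k (r i 0)) ⊆
        Finset.univ.filter fun u => γ i u ≠ γ i (r j 0) := by
      intro u hu
      have := GatedCycle.gate_eq_of_gate_ne hG (h i) (h k) (hr k i hik.symm) (hr i k hik)
        (Finset.mem_filter.1 hu).2
      refine Finset.mem_filter.2 ⟨Finset.mem_univ _, ?_⟩
      rw [this]
      exact fun e => hne e.symm
    obtain ⟨a, ha1, ha2⟩ : ∃ a, r i a ≠ γ i (r j 0) ∧ r i a ≠ γ i (r k 0) := by
      have hn : ∀ a b, a < 3 → b < 3 → a ≠ b → r i a ≠ r i b := fun a b ha hb hab e => by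
        have h3 := (h i).three_le
        rw [(h i).eq_iff, Nat.mod_eq_of_lt (by omega), Nat.mod_eq_of_lt (by omega)] at e
        exact hab e
      by_contra! hcon
      have n01 := hn 0 1 (by omega) (by omega) (by omega)
      have n02 := hn 0 2 (by omega) (by omega) (by omega)
      have n12 := hn 1 2 (by omega) (by omega) (by omega)
      have c0 := hcon 0
      have c1 := hcon 1
      have c2 := hcon 2
      by_cases e0 : r i 0 = γ i (r j 0) <;> by_cases e1 : r i 1 = γ i (r j 0) <;>
        by_cases e2 : r i 2 = γ i (r j 0)
      · exact n01 (e0.trans e1.symm)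
      · exact n01 (e0.trans e1.symm)
      · exact n02 (e0.trans e2.symm)
      · exact n12 ((c1 e1).trans (c2 e2).symm)
      · exact n12 (e1.trans e2.symm)
      · exact n02 ((c0 e0).trans (c2 e2).symm)
      · exact n01 ((c0 e0).trans (c1 e1).symm)
      · exact n01 ((c0 e0).trans (c1 e1).symm)
    refine Finset.sum_lt_sum_of_subset hsub (i := r i a) ?_ ?_ (hx _) fun u _ _ => (hx u).le
    · refine Finset.mem_filter.2 ⟨Finset.mem_univ _, ?_⟩
      rw [(h i).gate_self]
      exact ha1
    · intro hmem
      have := GatedCycle.gate_eq_of_gate_ne hG (h i) (h k) (hr k i hik.symm) (hr i k hik)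
        (Finset.mem_filter.1 hmem).2
      rw [(h i).gate_self] at this
      exact ha2 this
  exact absurd (hmin' k i hik.symm) (not_le.2 hlt)

/-- On a path, the potential at a vertex is at most the potential at one of the two ends. -/
theorem exists_order_potential_le {W : Type*} [Fintype W] {x : W → ℝ} (hx : ∀ v, 0 ≤ x v)
    {t : W → ℕ} {n : ℕ} (ht : ∀ v, t v < n) (hinj : Function.Injective t) (w : W) :
    ∃ t' : W → ℕ, (∀ v, t' v < n) ∧ Function.Injective t' ∧
      (∀ u v, |(t' u : ℝ) - t' v| = |(t u : ℝ) - t v|) ∧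
      ∑ q, x q * |(t w : ℝ) - t q| ≤ ∑ q, x q * (t' q : ℝ) := by
  have hwn := ht w
  have hcast : ∀ q, ((n - 1 - t q : ℕ) : ℝ) = (n - 1 : ℝ) - t q := fun q => by
    have := ht q
    rw [Nat.cast_sub (by omega), Nat.cast_sub (by omega)]
    simp
  by_cases h0 : ∑ q, x q * |(t w : ℝ) - t q| ≤ ∑ q, x q * (t q : ℝ)
  · exact ⟨t, ht, hinj, fun _ _ => rfl, h0⟩
  refine ⟨fun v => n - 1 - t v, fun v => show n - 1 - t v < n by omega, fun u v huv => ?_, fun u v => ?_, ?_⟩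
  · have h1 := ht u
    have h2 := ht v
    simp only at huv
    exact hinj (by omega)
  · rw [hcast, hcast, abs_sub_comm]
    congr 1
    ring
  · rw [not_le] at h0
    by_contra h1
    rw [not_le] at h1
    simp only [hcast] at h1
    have hN : (t w : ℝ) ≤ (n - 1 : ℝ) := by
      have : t w + 1 ≤ n := hwn
      have : ((t w + 1 : ℕ) : ℝ) ≤ n := by exact_mod_cast this
      push_cast at this
      linarith
    have ha : (0 : ℝ) ≤ t w := Nat.cast_nonneg _
    -- Convexity of `|· - t q|`, multiplied by `n - 1`: the value at `t w` is at most the weighted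
    -- mean of the values at the two ends. If the end `0` fails, the reversed order works.
    have hpt : ∀ q, (n - 1 : ℝ) * (x q * |(t w : ℝ) - t q|) ≤
        ((n - 1 : ℝ) - t w) * (x q * t q) + t w * (x q * ((n - 1 : ℝ) - t q)) := by
      intro q
      have hq0 : (0 : ℝ) ≤ t q := Nat.cast_nonneg _
      have hqN : (t q : ℝ) ≤ (n - 1 : ℝ) := by
        have : ((t q + 1 : ℕ) : ℝ) ≤ n := by exact_mod_cast ht q
        push_cast at this
        linarith
      have key : (n - 1 : ℝ) * |(t w : ℝ) - t q| ≤
          ((n - 1 : ℝ) - t w) * t q + t w * ((n - 1 : ℝ) - t q) := by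
        rcases le_total (t w : ℝ) (t q) with hle | hle
        · rw [abs_of_nonpos (by linarith)]
          nlinarith [mul_le_mul_of_nonneg_left hqN ha]
        · rw [abs_of_nonneg (by linarith)]
          nlinarith [mul_le_mul_of_nonneg_right hN hq0]
      nlinarith [mul_le_mul_of_nonneg_left key (hx q)]
    have hsum := Finset.sum_le_sum fun q (_ : q ∈ Finset.univ) => hpt q
    rw [Finset.sum_add_distrib, ← Finset.mul_sum, ← Finset.mul_sum, ← Finset.mul_sum] at hsum
    rcases ha.lt_or_eq with hpos | hzero
    · have e1 := mul_le_mul_of_nonneg_left h0.le (sub_nonneg.2 hN)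
      have e2 := mul_lt_mul_of_pos_left h1 hpos
      nlinarith
    · rw [← hzero] at h0
      refine absurd h0 (not_lt.2 (Finset.sum_le_sum fun q _ => ?_))
      rw [zero_sub, abs_neg, abs_of_nonneg (Nat.cast_nonneg _)]

/-- The heaviest pile and its complement both weigh at least `P`, and together they weigh `∑ u, x u
+ P`. A product with fixed sum and factors at least `P` is smallest when one factor equals `P`. The
complement is heavy enough either because it contains `w` with its extra weight, or by `hP`. -/
theorem pile_bound {W : Type*} [Fintype W] [DecidableEq W] {x : W → ℝ} (hx : ∀ u, 0 ≤ x u) {P : ℝ}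
    (hP0 : 0 ≤ P) {r : ℕ → W} {γ : W → W} {w : W} {a k : ℕ} (ha : γ w = r a)
    (hP : P ≤ ∑ u with γ u ≠ γ w, x u)
    (hmax : ∀ j, ∑ u with γ u = r j, (x u + if u = w then P else 0) ≤
      ∑ u with γ u = r k, (x u + if u = w then P else 0)) :
    P * ∑ u, x u ≤ (∑ u with γ u = r k, (x u + if u = w then P else 0)) *
      (∑ u, (x u + if u = w then P else 0) -
        ∑ u with γ u = r k, (x u + if u = w then P else 0)) := by
  set y : W → ℝ := fun u => x u + if u = w then P else 0 with hy
  have hy0 : ∀ u, 0 ≤ y u := fun u => add_nonneg (hx u) (by split_ifs <;> simp [hP0])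
  have hyw : P ≤ y w := by simp [hy, hx]
  have hS : ∑ u, y u = ∑ u, x u + P := by simp [hy, Finset.sum_add_distrib]
  have hM : P ≤ ∑ u with γ u = r k, y u := by
    refine le_trans (hyw.trans ?_) (hmax a)
    exact Finset.single_le_sum (fun u _ => hy0 u) (by simp [ha])
  have hsplit := Finset.sum_filter_add_sum_filter_not Finset.univ (fun u => γ u = r k) y
  have hM' : P ≤ ∑ u with ¬ γ u = r k, y u := by
    by_cases hk : γ w = r k
    · refine hP.trans ?_
      rw [← hk]
      refine Finset.sum_le_sum fun u _ => ?_
      simp only [hy]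
      split_ifs <;> simp [hP0]
    · refine hyw.trans ?_
      exact Finset.single_le_sum (fun u _ => hy0 u) (by simp [hk])
  rw [hS] at hsplit ⊢
  nlinarith [mul_nonneg (sub_nonneg.2 hM) (sub_nonneg.2 hM')]

set_option maxHeartbeats 2000000 in
/-- The part hanging at `w` can be ordered along a path starting near the cycle, so that its
distance form, with an extra weight `P` put at `w`, grows by at least `2 * P` times its weight. -/
theorem exists_pile_order {G : SimpleGraph V} (hG : G.Connected) {ℓ₁ ℓ₂ ℓ₃ : ℕ}
    {r₁ r₂ r₃ : ℕ → V} {γ₁ γ₂ γ₃ : V → V} (h₁ : GatedCycle G ℓ₁ r₁ γ₁)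
    (h₂ : GatedCycle G ℓ₂ r₂ γ₂) (h₃ : GatedCycle G ℓ₃ r₃ γ₃) {w : V} (hw : γ₁ w = w)
    (hw₂ : ∀ j, γ₁ (r₂ j) = w) (hw₃ : ∀ j, γ₁ (r₃ j) = w)
    (h₂₃ : ∀ i j, γ₂ (r₃ i) = γ₂ (r₃ j)) (h₃₂ : ∀ i j, γ₃ (r₂ i) = γ₃ (r₂ j))
    (hc₂ : ∀ u, γ₂ u ≠ γ₂ w → γ₁ u = w) (hc₃ : ∀ u, γ₃ u ≠ γ₃ w → γ₁ u = w)
    {x : V → ℝ} (hx : ∀ v, 0 < x v) {P : ℝ} (hP0 : 0 ≤ P)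
    (hP₂ : P ≤ ∑ u with γ₂ u ≠ γ₂ w, x u) (hP₃ : P ≤ ∑ u with γ₃ u ≠ γ₃ w, x u)
    {Q : Finset V} (hQ : ∀ u, u ∈ Q ↔ γ₁ u = w) :
    ∃ t : V → ℕ, (∀ u ∈ Q, t u < Q.card) ∧ Set.InjOn t Q ∧
      kerForm Q (fun u v => (G.dist u v : ℝ)) x + 2 * (P * ∑ q ∈ Q, x q * (G.dist w q : ℝ)) +
        2 * (P * ∑ q ∈ Q, x q) ≤
      kerForm Q (fun u v => |(t u : ℝ) - t v|) x + 2 * (P * ∑ q ∈ Q, x q * (t q : ℝ)) := by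
  set H := G.comap (Subtype.val : {u // γ₁ u = w} → V) with hH
  have hHconn : H.Connected := h₁.pile_connected hG hw
  have hγ₂ : ∀ u, γ₁ (γ₂ u) = w := fun u => by
    obtain ⟨j, hj⟩ := h₂.gate_mem u
    rw [hj, hw₂]
  have hγ₃ : ∀ u, γ₁ (γ₃ u) = w := fun u => by
    obtain ⟨j, hj⟩ := h₃.gate_mem u
    rw [hj, hw₃]
  have g₂ := h₂.induce (S := fun u => γ₁ u = w) hw₂ hγ₂
  have g₃ := h₃.induce (S := fun u => γ₁ u = w) hw₃ hγ₃
  have hsum : ∀ F : V → ℝ, ∑ u : {u // γ₁ u = w}, F u = ∑ u ∈ Q, F u := fun F =>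
    (Finset.sum_subtype Q (p := fun u => γ₁ u = w) hQ F).symm
  have hsub : ∀ γ : V → V, (∀ u, γ u ≠ γ w → γ₁ u = w) → ∀ hγ : ∀ u, γ₁ (γ u) = w,
      ∑ u with γ u ≠ γ w, x u ≤ ((Finset.univ : Finset {u // γ₁ u = w}).filter
        fun u : {u // γ₁ u = w} => (⟨γ u, hγ u⟩ : {u // γ₁ u = w}) ≠ ⟨γ w, hγ w⟩).sum
        fun u : {u // γ₁ u = w} => x u := by
    intro γ hc hγ
    simp only [ne_eq, Subtype.mk.injEq]
    rw [Finset.sum_filter, Finset.sum_filter, hsum (fun u => if ¬ γ u = γ w then x u else 0)]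
    refine le_of_eq (Finset.sum_subset (Finset.subset_univ Q) fun u _ hu => ?_).symm
    rw [hQ] at hu
    rw [if_neg]
    exact fun e => hu (hc u e)
  have hcard : Fintype.card {u // γ₁ u = w} = Q.card := by
    rw [Fintype.card_subtype]
    congr 1
    ext u
    simp [hQ]
  obtain ⟨a₂, ha₂⟩ := g₂.gate_mem ⟨w, hw⟩
  obtain ⟨a₃, ha₃⟩ := g₃.gate_mem ⟨w, hw⟩
  -- Both cycles lie in the pile at `w`. The added `P` stands for everything outside the pile,
  -- concentrated at `w`.
  obtain ⟨t, ht, hinj, hle⟩ := exists_path_order_of_two_cycles hHconn g₂ g₃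
    (fun i j => Subtype.ext (h₃₂ i j)) (fun i j => Subtype.ext (h₂₃ i j))
    (y := fun u => x u + if u = (⟨w, hw⟩ : {u // γ₁ u = w}) then P else 0)
    (fun u => add_nonneg (hx u).le (by split_ifs <;> simp [hP0]))
    (β := P * ∑ u : {u // γ₁ u = w}, x u)
    (fun k hk => pile_bound (fun u => (hx _).le) hP0 ha₂ (hP₂.trans (hsub γ₂ hc₂ hγ₂)) hk)
    (fun k hk => pile_bound (fun u => (hx _).le) hP0 ha₃ (hP₃.trans (hsub γ₃ hc₃ hγ₃)) hk)
  obtain ⟨t', ht', hinj', habs, hpot⟩ := exists_order_potential_le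
    (x := fun u : {u // γ₁ u = w} => x u) (fun u => (hx _).le) ht hinj ⟨w, hw⟩
  have e1 := kerForm_add_single (Finset.mem_univ (⟨w, hw⟩ : {u // γ₁ u = w}))
    (k := fun u v => (H.dist u v : ℝ)) (fun a b => by rw [H.dist_comm]) (fun a => by simp)
    (fun u => x u) P
  have e2 := kerForm_add_single (Finset.mem_univ (⟨w, hw⟩ : {u // γ₁ u = w}))
    (k := fun u v => |(t u : ℝ) - t v|) (fun a b => abs_sub_comm _ _) (fun a => by simp)
    (fun u => x u) P
  have e1' : distForm H (fun u => x u + if u = (⟨w, hw⟩ : {u // γ₁ u = w}) then P else 0) = _ := e1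
  have hle' := hle
  rw [e1'] at hle'
  have hle2 := hle'.trans (le_of_eq e2)
  have hdist : ∀ u v : {u // γ₁ u = w}, (G.dist u v : ℝ) ≤ H.dist u v := fun u v => by
    obtain ⟨p, hp⟩ := (hHconn.preconnected u v).exists_walk_length_eq_dist
    have := G.dist_le (p.map (SimpleGraph.Hom.comap Subtype.val G))
    rw [SimpleGraph.Walk.length_map, hp] at this
    exact_mod_cast this
  refine ⟨fun v => if hv : γ₁ v = w then t' ⟨v, hv⟩ else 0, fun u hu => ?_, fun u hu v hv huv => ?_,
    ?_⟩
  · rw [hQ] at hu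
    simp only [hu, dif_pos]
    rw [← hcard]
    exact ht' _
  · have hu' := (hQ u).1 hu
    have hv' := (hQ v).1 hv
    simp only [hu', hv', dif_pos] at huv
    exact congrArg Subtype.val (hinj' huv)
  · have hker : ∀ K : V → V → ℝ, kerForm Q K x =
        ∑ u : {u // γ₁ u = w}, ∑ v : {u // γ₁ u = w}, x u * x v * K u v := fun K => by
      unfold kerForm
      rw [← hsum]
      exact Finset.sum_congr rfl fun u _ => (hsum fun v => x u * x v * K u v).symm
    rw [hker, hker, ← hsum, ← hsum, ← hsum]
    have d1 : ∀ u : {u // γ₁ u = w}, (if hv : γ₁ (u : V) = w then t' ⟨u, hv⟩ else 0) = t' u :=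
      fun u => by simp only [u.2, dif_pos]
    simp only [d1, habs]
    have f1 : ∑ u : {u // γ₁ u = w}, ∑ v : {u // γ₁ u = w}, x u * x v * (G.dist u v : ℝ) ≤
        kerForm Finset.univ (fun u v => (H.dist u v : ℝ)) (fun u : {u // γ₁ u = w} => x u) :=
      Finset.sum_le_sum fun u _ => Finset.sum_le_sum fun v _ =>
        mul_le_mul_of_nonneg_left (hdist u v) (mul_nonneg (hx _).le (hx _).le)
    have f2 : ∑ q : {u // γ₁ u = w}, x q * (G.dist w q : ℝ) ≤
        ∑ q : {u // γ₁ u = w}, x q * (H.dist ⟨w, hw⟩ q : ℝ) :=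
      Finset.sum_le_sum fun q _ => mul_le_mul_of_nonneg_left (hdist ⟨w, hw⟩ q) (hx _).le
    have f3 : kerForm Finset.univ (fun u v => |(t u : ℝ) - t v|)
        (fun u : {u // γ₁ u = w} => x u) =
        ∑ u : {u // γ₁ u = w}, ∑ v : {u // γ₁ u = w}, x u * x v * |(t u : ℝ) - t v| := rfl
    rw [f3] at hle2
    have f4 := mul_le_mul_of_nonneg_left f2 hP0
    have f5 := mul_le_mul_of_nonneg_left hpot hP0
    linarith

end Selection

end DistSpec

/-! ### Kite distances and the final gluing. -/

namespace DistSpec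

section Kite

theorem kite_connected {k n : ℕ} (hn : 0 < n) : (kite k n).Connected := by
  have : NeZero n := ⟨hn.ne'⟩
  have key : ∀ a (ha : a < n), (kite k n).Reachable ⟨0, hn⟩ ⟨a, ha⟩ := by
    intro a
    induction a with
    | zero => exact fun _ => SimpleGraph.Reachable.refl _
    | succ a ih =>
      intro ha
      refine (ih (by omega)).trans (SimpleGraph.Adj.reachable ⟨?_, Or.inr (Or.inl rfl)⟩)
      simp
  exact (SimpleGraph.connected_iff_exists_forall_reachable _).2 ⟨⟨0, hn⟩, fun v => key v v.2⟩

/-- The function `i ↦ max i (k - 2)` is 1-Lipschitz on the kite graph. -/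
theorem max_le_max_add_dist_kite {k n : ℕ} (i j : Fin n) :
    max i.val (k - 2) ≤ max j.val (k - 2) + (kite k n).dist i j := by
  obtain ⟨p, hp⟩ := (kite_connected (k := k) (Fin.pos i)).exists_walk_length_eq_dist i j
  rw [← hp]
  clear hp
  induction p with
  | nil => simp
  | cons h p ih =>
    rw [SimpleGraph.Walk.length_cons]
    obtain ⟨-, h⟩ := h
    omega

theorem one_le_dist_kite {k n : ℕ} {i j : Fin n} (hij : i ≠ j) : 1 ≤ (kite k n).dist i j :=
  (kite_connected (Fin.pos i)).pos_dist_of_ne hij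

end Kite

section Assembly

variable {V : Type*}

theorem kerForm_univ_eq_add_compl [Fintype V] [DecidableEq V] (s : Finset V) {k : V → V → ℝ}
    (hk : ∀ u v, k u v = k v u) (y : V → ℝ) :
    kerForm Finset.univ k y = kerForm s k y + kerForm sᶜ k y +
      2 * ∑ u ∈ s, ∑ v ∈ sᶜ, y u * y v * k u v := by
  have hc : ∑ u ∈ sᶜ, ∑ v ∈ s, y u * y v * k u v = ∑ u ∈ s, ∑ v ∈ sᶜ, y u * y v * k u v := by
    rw [Finset.sum_comm]
    refine Finset.sum_congr rfl fun u _ => Finset.sum_congr rfl fun v _ => ?_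
    rw [hk v u]
    ring
  unfold kerForm
  rw [← Finset.sum_add_sum_compl s]
  simp_rw [← Finset.sum_add_sum_compl s (fun v => _ * y v * k _ v)]
  rw [Finset.sum_add_distrib, Finset.sum_add_distrib, hc]
  ring

/-- A sum of a separated kernel over a product. -/
theorem sum_sum_mul_add (s s' : Finset V) (y a b : V → ℝ) :
    ∑ u ∈ s, ∑ v ∈ s', y u * y v * (a u + b v) =
      (∑ v ∈ s', y v) * ∑ u ∈ s, y u * a u + (∑ u ∈ s, y u) * ∑ v ∈ s', y v * b v := by
  rw [mul_comm (∑ v ∈ s', y v), Finset.sum_mul_sum, Finset.sum_mul_sum, ← Finset.sum_add_distrib]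
  refine Finset.sum_congr rfl fun u _ => ?_
  rw [← Finset.sum_add_distrib]
  exact Finset.sum_congr rfl fun v _ => by ring

/-- Gluing a comparison on `X`, up to slacks `σ`, with a comparison on the complement of `X`. -/
theorem kerForm_lt_of_glue [Fintype V] [DecidableEq V] {X : Finset V} {D N : V → V → ℝ}
    {x δ σ τ ε : V → ℝ} (hx : ∀ v, 0 < x v) (hD : ∀ u v, D u v = D v u)
    (hN : ∀ u v, N u v = N v u) (hσ : ∀ u ∈ X, 0 ≤ σ u)
    (hle : ∑ u ∈ X, x u ≤ ∑ q ∈ Xᶜ, x q)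
    (hX : ∀ u ∈ X, ∀ v ∈ X, D u v ≤ N u v + (σ u + σ v))
    (hDc : ∀ u ∈ X, ∀ q ∈ Xᶜ, D u q ≤ δ u + ε q)
    (hNc : ∀ u ∈ X, ∀ q ∈ Xᶜ, (δ u + σ u - 1) + τ q ≤ N u q)
    (hQ : kerForm Xᶜ D x + 2 * ((∑ u ∈ X, x u) * ∑ q ∈ Xᶜ, x q * ε q) +
      2 * ((∑ u ∈ X, x u) * ∑ q ∈ Xᶜ, x q) ≤
      kerForm Xᶜ N x + 2 * ((∑ u ∈ X, x u) * ∑ q ∈ Xᶜ, x q * τ q))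
    (hlt : (∃ u ∈ X, ∃ v ∈ X, D u v < N u v + (σ u + σ v)) ∨
      ∃ u ∈ X, ∃ q ∈ Xᶜ, (δ u + σ u - 1) + τ q < N u q) :
    kerForm Finset.univ D x < kerForm Finset.univ N x := by
  have hxx : ∀ u v, 0 < x u * x v := fun u v => mul_pos (hx u) (hx v)
  rw [kerForm_univ_eq_add_compl X hD, kerForm_univ_eq_add_compl X hN]
  have eX : ∑ u ∈ X, ∑ v ∈ X, x u * x v * (N u v + (σ u + σ v)) =
      kerForm X N x + 2 * ((∑ u ∈ X, x u) * ∑ u ∈ X, x u * σ u) := by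
    rw [two_mul, ← sum_sum_mul_add, kerForm, ← Finset.sum_add_distrib]
    refine Finset.sum_congr rfl fun u _ => ?_
    rw [← Finset.sum_add_distrib]
    exact Finset.sum_congr rfl fun v _ => by ring
  have hDle : ∑ u ∈ X, ∑ q ∈ Xᶜ, x u * x q * D u q ≤
      ∑ u ∈ X, ∑ q ∈ Xᶜ, x u * x q * (δ u + ε q) :=
    Finset.sum_le_sum fun u hu => Finset.sum_le_sum fun q hq =>
      mul_le_mul_of_nonneg_left (hDc u hu q hq) (hxx u q).le
  rw [sum_sum_mul_add] at hDle
  have eN : ∑ u ∈ X, ∑ q ∈ Xᶜ, x u * x q * ((δ u + σ u - 1) + τ q) =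
      (∑ q ∈ Xᶜ, x q) * (∑ u ∈ X, x u * δ u + ∑ u ∈ X, x u * σ u - ∑ u ∈ X, x u) +
        (∑ u ∈ X, x u) * ∑ q ∈ Xᶜ, x q * τ q := by
    rw [sum_sum_mul_add, ← Finset.sum_add_distrib, ← Finset.sum_sub_distrib]
    congr 2
    exact Finset.sum_congr rfl fun u _ => by ring
  have hXle : kerForm X D x ≤ ∑ u ∈ X, ∑ v ∈ X, x u * x v * (N u v + (σ u + σ v)) :=
    Finset.sum_le_sum fun u hu => Finset.sum_le_sum fun v hv =>
      mul_le_mul_of_nonneg_left (hX u hu v hv) (hxx u v).le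
  have hNle : ∑ u ∈ X, ∑ q ∈ Xᶜ, x u * x q * ((δ u + σ u - 1) + τ q) ≤
      ∑ u ∈ X, ∑ q ∈ Xᶜ, x u * x q * N u q :=
    Finset.sum_le_sum fun u hu => Finset.sum_le_sum fun q hq =>
      mul_le_mul_of_nonneg_left (hNc u hu q hq) (hxx u q).le
  -- The slacks cost at most `2 * x(X) * ∑ x σ` inside `X` and return `2 * x(Xᶜ) * ∑ x σ` in the
  -- cross terms.
  have hmul := mul_le_mul_of_nonneg_right hle
    (Finset.sum_nonneg fun u hu => mul_nonneg (hx u).le (hσ u hu))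
  rcases hlt with ⟨u, hu, v, hv, huv⟩ | ⟨u, hu, q, hq, huq⟩
  · have hXlt : kerForm X D x < ∑ u ∈ X, ∑ v ∈ X, x u * x v * (N u v + (σ u + σ v)) :=
      Finset.sum_lt_sum (fun u hu => Finset.sum_le_sum fun v hv =>
        mul_le_mul_of_nonneg_left (hX u hu v hv) (hxx u v).le)
        ⟨u, hu, Finset.sum_lt_sum (fun v hv =>
          mul_le_mul_of_nonneg_left (hX u hu v hv) (hxx u v).le)
          ⟨v, hv, mul_lt_mul_of_pos_left huv (hxx u v)⟩⟩
    rw [eX] at hXlt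
    rw [eN] at hNle
    linarith
  · have hNlt : ∑ u ∈ X, ∑ q ∈ Xᶜ, x u * x q * ((δ u + σ u - 1) + τ q) <
        ∑ u ∈ X, ∑ q ∈ Xᶜ, x u * x q * N u q :=
      Finset.sum_lt_sum (fun u hu => Finset.sum_le_sum fun q hq =>
        mul_le_mul_of_nonneg_left (hNc u hu q hq) (hxx u q).le)
        ⟨u, hu, Finset.sum_lt_sum (fun q hq =>
          mul_le_mul_of_nonneg_left (hNc u hu q hq) (hxx u q).le)
          ⟨q, hq, mul_lt_mul_of_pos_left huq (hxx u q)⟩⟩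
    rw [eX] at hXle
    rw [eN] at hNlt
    linarith

/-- Bijections of the two parts of a vertex set onto intervals glue to an enumeration. -/
theorem exists_equiv_fin_of_two_orders [Fintype V] [DecidableEq V] {X : Finset V} {m : ℕ}
    (hm : X.card = m) {c t : V → ℕ} (hc : ∀ u ∈ X, c u < m) (hcinj : Set.InjOn c X)
    (ht : ∀ u ∈ Xᶜ, t u < Xᶜ.card) (htinj : Set.InjOn t (Xᶜ : Finset V)) :
    ∃ σ : V ≃ Fin (Fintype.card V), (∀ u ∈ X, (σ u : ℕ) = c u) ∧
      ∀ u ∈ Xᶜ, (σ u : ℕ) = m + t u := by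
  have hcard := Finset.card_add_card_compl X
  have hlt : ∀ u, (if u ∈ X then c u else m + t u) < Fintype.card V := fun u => by
    split_ifs with hu
    · have := hc u hu
      omega
    · have := ht u (Finset.mem_compl.2 hu)
      omega
  have hinj : Function.Injective fun u => (⟨_, hlt u⟩ : Fin (Fintype.card V)) := by
    intro u v huv
    rw [Fin.mk.injEq] at huv
    split_ifs at huv with hu hv hv
    · exact hcinj hu hv huv
    · have := hc u hu
      omega
    · have := hc v hv
      omega
    · exact htinj (Finset.mem_coe.2 (Finset.mem_compl.2 hu))
        (Finset.mem_coe.2 (Finset.mem_compl.2 hv)) (by omega)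
  refine ⟨Equiv.ofBijective _ ((Fintype.bijective_iff_injective_and_card _).2
    ⟨hinj, (Fintype.card_fin _).symm⟩), fun u hu => ?_, fun u hu => ?_⟩
  · simp [hu]
  · simp [Finset.mem_compl.1 hu]

theorem exists_mem_eq_zero_of_injOn {s : Finset V} (hs : s.Nonempty) {t : V → ℕ}
    (ht : ∀ u ∈ s, t u < s.card) (hinj : Set.InjOn t s) : ∃ q ∈ s, t q = 0 := by
  have h : s.image t = Finset.range s.card :=
    Finset.eq_of_subset_of_card_le
      (fun a ha => by
        obtain ⟨u, hu, rfl⟩ := Finset.mem_image.1 ha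
        exact Finset.mem_range.2 (ht u hu))
      (by rw [Finset.card_image_of_injOn hinj, Finset.card_range])
  have h0 : 0 ∈ s.image t := h ▸ Finset.mem_range.2 (Finset.card_pos.2 hs)
  exact Finset.mem_image.1 h0

theorem distForm_comp_symm {W : Type*} [Fintype V] [Fintype W] (K : SimpleGraph W) (x : V → ℝ)
    (σ : V ≃ W) : distForm K (x ∘ σ.symm) =
      kerForm Finset.univ (fun u v => (K.dist (σ u) (σ v) : ℝ)) x := by
  unfold distForm kerForm
  rw [← Equiv.sum_comp σ]
  refine Finset.sum_congr rfl fun u _ => ?_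
  rw [← Equiv.sum_comp σ]
  simp

/-- `X` occupies positions `0, …, m - 1`, and the pile at `w` follows in its path order. Kite
distances are only bounded below, by `1` off the diagonal and through the 1-Lipschitz function `max
· 2`. -/
theorem exists_equiv_distForm_lt_kite [Fintype V] [DecidableEq V] {G : SimpleGraph V}
    (hG : G.Connected) {ℓ : Fin 3 → ℕ} {r : Fin 3 → ℕ → V} {γ : Fin 3 → V → V}
    (h : ∀ i, GatedCycle G (ℓ i) (r i) (γ i))
    (hr : ∀ i j, i ≠ j → ∀ a b, γ i (r j a) = γ i (r j b)) {x : V → ℝ} (hx : ∀ v, 0 < x v) :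
    ∃ σ : V ≃ Fin (Fintype.card V),
      distForm G x < distForm (kite 4 (Fintype.card V)) (x ∘ σ.symm) := by
  obtain ⟨i, j, k, hij, hik, hjk, hjk', hPj, hPk⟩ := exists_light_cycle hG h hr hx
  obtain ⟨a, ha⟩ := (h i).gate_mem (r j 0)
  obtain ⟨w, hw⟩ : ∃ w, w = γ i (r j 0) := ⟨_, rfl⟩
  have hwa : w = r i a := hw.trans ha
  have hww : γ i w = w := by rw [hwa, (h i).gate_self]
  have hwj : γ j w = γ j (r i 0) := by rw [hwa, hr j i hij.symm a 0]
  have hwk : γ k w = γ k (r i 0) := by rw [hwa, hr k i hik.symm a 0]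
  have hcj : ∀ u, γ j u ≠ γ j w → γ i u = w := fun u hu => by
    rw [hwj] at hu
    rw [hw]
    exact GatedCycle.gate_eq_of_gate_ne hG (h i) (h j) (hr j i hij.symm) (hr i j hij) hu
  have hck : ∀ u, γ k u ≠ γ k w → γ i u = w := fun u hu => by
    rw [hwk] at hu
    rw [hw, hjk']
    exact GatedCycle.gate_eq_of_gate_ne hG (h i) (h k) (hr k i hik.symm) (hr i k hik) hu
  rw [← hw, ← hwj] at hPj
  rw [← hw, ← hwk] at hPk
  set X : Finset V := Finset.univ.filter fun u => γ i u ≠ w with hXdef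
  have hX : ∀ u, u ∈ X ↔ γ i u ≠ w := fun u => by simp [hXdef]
  have hXc : ∀ u, u ∈ Xᶜ ↔ γ i u = w := fun u => by simp [hXdef]
  have hP0 : 0 ≤ ∑ u ∈ X, x u := Finset.sum_nonneg fun u _ => (hx u).le
  have hle : ∑ u ∈ X, x u ≤ ∑ q ∈ Xᶜ, x q :=
    hPj.trans (Finset.sum_le_sum_of_subset_of_nonneg
      (fun u hu => (hXc u).2 (hcj u (Finset.mem_filter.1 hu).2)) fun u _ _ => (hx u).le)
  obtain ⟨t, ht, htinj, hQ⟩ := exists_pile_order hG (h i) (h j) (h k) hww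
    (fun b => by rw [hw]; exact hr i j hij b 0) (fun b => by rw [hw, hjk']; exact hr i k hik b 0)
    (hr j k hjk) (hr k j hjk.symm) hcj hck hx hP0 hPj hPk hXc
  obtain ⟨m, hm⟩ : ∃ m, X.card = m := ⟨_, rfl⟩
  have h0 : r i (0 + a) = w := by rw [zero_add, hwa]
  obtain ⟨hm2, c, hc, hcinj, hc1, hc2, hc3⟩ := ((h i).rotate a).exists_kite_order hG
    (X := X) (by rw [h0]; exact hX) hm
  rw [h0] at hc1 hc2 hc3
  obtain ⟨σ, hσX, hσQ⟩ := exists_equiv_fin_of_two_orders hm hc hcinj ht htinj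
  refine ⟨σ, ?_⟩
  rw [distForm_comp_symm]
  have hNle : ∀ u v, max (σ u : ℕ) 2 ≤
      max (σ v : ℕ) 2 + (kite 4 (Fintype.card V)).dist (σ u) (σ v) :=
    fun u v => max_le_max_add_dist_kite (k := 4) (σ u) (σ v)
  have hN1 : ∀ u v, u ≠ v → 1 ≤ (kite 4 (Fintype.card V)).dist (σ u) (σ v) := fun u v huv =>
    one_le_dist_kite (σ.injective.ne huv)
  have hNc : ∀ u v, (kite 4 (Fintype.card V)).dist (σ u) (σ v) =
      (kite 4 (Fintype.card V)).dist (σ v) (σ u) := fun u v => SimpleGraph.dist_comm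
  -- The slack `σ u` is chosen so that `δ u + σ u - 1 = m - max (c u) 2`, the Lipschitz lower bound
  -- for the kite distance from `u` to position `m`.
  refine kerForm_lt_of_glue (X := X) (δ := fun u => (G.dist w u : ℝ))
    (σ := fun u => (m : ℝ) + 1 - (G.dist w u : ℝ) - ((max (c u) 2 : ℕ) : ℝ))
    (τ := fun q => (t q : ℝ)) (ε := fun q => (G.dist w q : ℝ)) hx
    (fun u v => by rw [SimpleGraph.dist_comm]) (fun u v => by rw [SimpleGraph.dist_comm])
    (fun u hu => ?_) hle (fun u hu v hv => ?_) (fun u hu q hq => ?_) (fun u hu q hq => ?_)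
    (hQ.trans (add_le_add_left (Finset.sum_le_sum fun u hu => Finset.sum_le_sum fun v hv =>
      mul_le_mul_of_nonneg_left ?_ (mul_pos (hx u) (hx v)).le) _)) ?_
  · have : ((G.dist w u + max (c u) 2 : ℕ) : ℝ) ≤ ((m + 1 : ℕ) : ℝ) := by exact_mod_cast hc1 u hu
    push_cast at this ⊢
    linarith
  · rcases eq_or_ne u v with rfl | huv
    · have : ((G.dist w u + max (c u) 2 : ℕ) : ℝ) ≤ ((m + 1 : ℕ) : ℝ) := by
        exact_mod_cast hc1 u hu
      rw [SimpleGraph.dist_self, SimpleGraph.dist_self]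
      push_cast at this ⊢
      linarith
    · have h1 := hc2 u hu v hv huv
      have h2 := hNle u v
      have h3 := hNle v u
      have h4 := hN1 u v huv
      rw [hNc v u] at h3
      rw [hσX u hu, hσX v hv] at h2 h3
      have : G.dist u v + G.dist w u + G.dist w v + max (c u) 2 + max (c v) 2 ≤
          2 * m + 2 + (kite 4 (Fintype.card V)).dist (σ u) (σ v) := by omega
      have : ((G.dist u v + G.dist w u + G.dist w v + max (c u) 2 + max (c v) 2 : ℕ) : ℝ) ≤
          ((2 * m + 2 + (kite 4 (Fintype.card V)).dist (σ u) (σ v) : ℕ) : ℝ) := by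
        exact_mod_cast this
      push_cast at this ⊢
      linarith
  · have := hG.dist_triangle (u := u) (v := w) (w := q)
    rw [SimpleGraph.dist_comm (u := u) (v := w)] at this
    exact_mod_cast this
  · have h2 := hNle q u
    rw [hNc q u, hσQ q hq, hσX u hu] at h2
    have : m + t q ≤ max (c u) 2 + (kite 4 (Fintype.card V)).dist (σ u) (σ q) := by omega
    have : ((m + t q : ℕ) : ℝ) ≤
        ((max (c u) 2 + (kite 4 (Fintype.card V)).dist (σ u) (σ q) : ℕ) : ℝ) := by
      exact_mod_cast this
    push_cast at this ⊢
    linarith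
  · have h2 := hNle u v
    have h3 := hNle v u
    rw [hNc v u] at h3
    rw [hσQ u hu, hσQ v hv] at h2 h3
    rw [abs_le]
    have h2' : t u ≤ t v + (kite 4 (Fintype.card V)).dist (σ u) (σ v) := by omega
    have h3' : t v ≤ t u + (kite 4 (Fintype.card V)).dist (σ u) (σ v) := by omega
    have h2'' : (t u : ℝ) ≤ t v + (kite 4 (Fintype.card V)).dist (σ u) (σ v) := by
      exact_mod_cast h2'
    have h3'' : (t v : ℝ) ≤ t u + (kite 4 (Fintype.card V)).dist (σ u) (σ v) := by
      exact_mod_cast h3'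
    constructor <;> linarith
  -- For `m = 2` the Lipschitz bound from `u` to position `2` is `0`, while the distance is at least
  -- `1`. Otherwise some `u` has positive slack, and the diagonal pair `(u, u)` is strict.
  · rcases hc3 with rfl | ⟨u, hu, hu'⟩
    · right
      obtain ⟨q, hq, hq0⟩ := exists_mem_eq_zero_of_injOn ⟨w, (hXc w).2 hww⟩ ht htinj
      obtain ⟨u, hu⟩ : X.Nonempty := Finset.card_pos.1 (by omega)
      refine ⟨u, hu, q, hq, ?_⟩
      have huq : u ≠ q := by
        rintro rfl
        exact Finset.mem_compl.1 hq hu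
      have h1 : (1 : ℝ) ≤ (kite 4 (Fintype.card V)).dist (σ u) (σ q) := by
        exact_mod_cast hN1 u q huq
      have h2 : (2 : ℝ) ≤ ((max (c u) 2 : ℕ) : ℝ) := by exact_mod_cast le_max_right _ _
      rw [hq0]
      push_cast at h2 ⊢
      linarith
    · left
      refine ⟨u, hu, u, hu, ?_⟩
      have : ((G.dist w u + max (c u) 2 : ℕ) : ℝ) ≤ (m : ℝ) := by exact_mod_cast hu'
      rw [SimpleGraph.dist_self, SimpleGraph.dist_self]
      push_cast at this ⊢
      linarith

theorem distForm_anti [Fintype V] {G₀ G : SimpleGraph V} (hle : G₀ ≤ G) (hG₀ : G₀.Connected)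
    {x : V → ℝ} (hx : ∀ v, 0 < x v) : distForm G x ≤ distForm G₀ x :=
  Finset.sum_le_sum fun u _ => Finset.sum_le_sum fun v _ =>
    mul_le_mul_of_nonneg_left (by exact_mod_cast (hG₀ u v).dist_anti hle)
      (mul_pos (hx u) (hx v)).le

end Assembly

end DistSpec

theorem mainTheorem6 {V : Type*} [Fintype V] [DecidableEq V] (G : SimpleGraph V) (n : ℕ)
    (hn : Fintype.card V = n) (hG : G.Connected)
    (hC : ∃ G₁ G₂ G₃ : G.Subgraph, DistSpec.AreCactusTypeCycles G₁ G₂ G₃) :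
    DistSpec.distSpectralRadius G < DistSpec.distSpectralRadius (DistSpec.kite 4 n) := by
  subst hn
  obtain ⟨G₁, G₂, G₃, hC⟩ := hC
  obtain ⟨G₀, hle, hG₀, ℓ, r, γ, h, hr⟩ := DistSpec.exists_three_gatedCycles hG hC
  have : Nontrivial V := ⟨_, _, ((h 0).adj 0).ne⟩
  refine DistSpec.distSpectralRadius_lt_of_distForm_lt hG _ fun x hx => ?_
  obtain ⟨σ, hσ⟩ := DistSpec.exists_equiv_distForm_lt_kite hG₀ h hr hx
  exact ⟨σ, (DistSpec.distForm_anti hle hG₀ hx).trans_lt hσ⟩
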